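/- **Lemma (Multi-Group Variance Estimation).** Let $(y_{i,k})_{i\ge 1,k\ge 1}$ be independent real random variables such that, for each group $i$, the observations $y_{i,1},y_{i,2},\dots$ are identically distributed, with mean $m_i$, variance $\eta_i^2$ and finite fourth central moment $\mu_{4,i}=\mathbb E[(y_{i,1}-m_i)^4]$. For $n$ observations per group put $$\bar y_i=\frac1n\sum_{k=1}^n y_{i,k},\qquad \bar\eta_i^2=\frac1{n-1}\sum_{k=1}^n (y_{i,k}-\bar y_i)^2,\qquad \bar\mu_{4,i}=\frac1n\sum_{k=1}^n (y_{i,k}-\bar y_i)^4 .$$ Let $V_L=\sum_{i=1}^L(\mu_{4,i}-(\eta_i^2)^2)$, and assume that $\mu_{4,i}>(\eta_i^2)^2$ for at least one $i$. Let $0<\beta<1$, let $z_\beta$ be the upper critical value of the standard normal distribution, $\Pr(Z\le z_\beta)=1-\beta$, and let $$p_{L,n}=P\left(\sum_{i=1}^L\eta_i^2\ \ge\ \sum_{i=1}^L\bar\eta_i^2-z_\beta\sqrt{\sum_{i=1}^L\frac1n\left(\bar\mu_{4,i}-(\bar\eta_i^2)^2\right)}\right),$$ where the square root of a negative number is read as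 $0$. (i) For every $L$ with $V_L>0$ (hence for all large $L$), $p_{L,n}\to1-\beta$ as $n\to\infty$. In particular $\lim_{L\to\infty}\lim_{n\to\infty}p_{L,n}=1-\beta$. (ii) Suppose moreover that the fourth moments are uniform over the groups in the following sense: there is a constant $C$ with $\sum_{i=1}^L\mu_{4,i}\le C\,V_L$ for all large $L$, and for every $\varepsilon>0$ there is a $K$ such that for all large $L$ $$\sum_{i=1}^L \mathbb E\left[(y_{i,1}-m_i)^4\,\mathbf 1\{(y_{i,1}-m_i)^4>K\,V_L\}\right]\le\varepsilon\, V_L .$$ (This holds, for instance, if all groups have the same distribution, or if all outcomes lie in a common bounded interval and $\mu_{4,i}-(\eta_i^2)^2\ge c$ for all $i$ and some $c>0$.) Then $p_{L,n}\to1-\beta$ as $L$ and $n$ tend to infinity jointly, in any manner: for every $\varepsilon>0$ there is an $N$ with $|p_{L,n}-(1-\beta)|<\varepsilon$ for all $L,n\ge N$. -/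

import Mathlib

open MeasureTheory ProbabilityTheory Filter Topology

noncomputable section

namespace MultiGroup

/-- Sample mean of the first `n` observations. -/
def sampleMean (n : ℕ) (x : ℕ → ℝ) : ℝ :=
  (∑ k ∈ Finset.range n, x k) / n

/-- Sample variance of the first `n` observations, with the factor `1 / (n - 1)`
(the subtraction is the one of the real numbers). -/
def sampleVariance (n : ℕ) (x : ℕ → ℝ) : ℝ :=
  (∑ k ∈ Finset.range n, (x k - sampleMean n x) ^ 2) / ((n : ℝ) - 1)

/-- Sample fourth central moment of the first `n` observations, with the factor `1 / n`. -/
def sampleFourthMoment (n : ℕ) (x : ℕ → ℝ) : ℝ :=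
  (∑ k ∈ Finset.range n, (x k - sampleMean n x) ^ 4) / n

/-- The estimated lower bound for the total variance of the first `L` groups, computed from the
first `n` observations of each; `y i k` is the `k`-th observation in the `i`-th group. -/
def lowerBound (z : ℝ) (L n : ℕ) (y : ℕ → ℕ → ℝ) : ℝ :=
  ∑ i ∈ Finset.range L, sampleVariance n (y i)
    - z * √(∑ i ∈ Finset.range L,
        1 / (n : ℝ) * (sampleFourthMoment n (y i) - sampleVariance n (y i) ^ 2))

variable {Ω : Type*} [MeasurableSpace Ω]

/-- The total true variance of the groups `0, …, L - 1`, where `X i` has the distribution of the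
observations in the `i`-th group. -/
def totalVariance (P : Measure Ω) (X : ℕ → Ω → ℝ) (L : ℕ) : ℝ :=
  ∑ i ∈ Finset.range L, variance (X i) P

/-- The sum over the groups `0, …, L - 1` of (true fourth central moment) - (true variance)². -/
def totalExcess (P : Measure Ω) (X : ℕ → Ω → ℝ) (L : ℕ) : ℝ :=
  ∑ i ∈ Finset.range L, (centralMoment (X i) 4 P - variance (X i) P ^ 2)

/-- Lindeberg-type uniformity of the fourth central moments over the groups. -/
structure UniformFourthMoments (P : Measure Ω) (X : ℕ → Ω → ℝ) : Prop where
  bounded : ∃ C : ℝ, ∀ᶠ L in atTop,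
    ∑ i ∈ Finset.range L, centralMoment (X i) 4 P ≤ C * totalExcess P X L
  tails : ∀ ε : ℝ, 0 < ε → ∃ K : ℝ, ∀ᶠ L in atTop,
    ∑ i ∈ Finset.range L,
      ∫ ω in {ω | K * totalExcess P X L < (X i ω - ∫ ω', X i ω' ∂P) ^ 4},
        (X i ω - ∫ ω', X i ω' ∂P) ^ 4 ∂P ≤ ε * totalExcess P X L

end MultiGroup

end

/-! ### Lindeberg's central limit theorem via characteristic functions. -/

namespace MultiGroup

/-! Write d = y - m for the centered observations and V for the total excess of the first L groups.
Algebra (`sampleVariance_sub`, `lowerBound_le_iff`) turns the coverage event into W + Q ≤ 0. Here W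
is the sum of all (d² - η²) / √(nV), and Q = -(R + ((n-1)/n) z √E), where R is the sum over groups
of (Σ_k d)²/n - η², divided by √(nV), and E is the sum of the estimated excesses divided by V.

The independent summands of W are centered with total variance 1, so W tends to a standard normal Z
by `tendstoInDistribution_of_lindeberg`. R is of order 1/√n in L¹, because its group terms are
centered, independent and have second moment at most 3μ₄ (`integral_abs_mean_le`). E tends to 1 in
L¹ (`tendsto_integral_abs_estimator_sub`): using sample means instead of true means costs O(Σμ₄/√n),
and the averages of d⁴ obey a weak law proved by truncation. Hence Q tends to -z in probability, and
Slutsky's theorem gives P(W + Q ≤ 0) → P(Z ≤ z) = 1 - β.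

Relative to V, all error bounds involve only n, a constant C with Σμ₄ ≤ CV, and the fourth-moment
tails above levels KV. They therefore hold along any sequence (L_j, n_j) with n_j → ∞ that satisfies
`UniformAlong`. A constant L satisfies it automatically, which gives (i). For (ii), a limit along
the product filter can be tested on sequences. -/

/-- Both bounds are needed: the cubic one gains a factor ε where the variable is small, and the
quadratic one needs only second moments where it is large. Taylor's bound serves |x| ≤ 1, the
triangle inequality the rest. -/
lemma norm_exp_mul_I_sub_le (x : ℝ) :
    ‖Complex.exp (x * Complex.I) - (1 + x * Complex.I - (x : ℂ) ^ 2 / 2)‖ ≤ 3 * x ^ 2 ∧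
    ‖Complex.exp (x * Complex.I) - (1 + x * Complex.I - (x : ℂ) ^ 2 / 2)‖ ≤ 3 * |x| ^ 3 := by
  have hx0 : 0 ≤ |x| := abs_nonneg x
  have hsq : x ^ 2 = |x| ^ 2 := (sq_abs x).symm
  rcases le_total |x| 1 with hx | hx
  · have hn : ‖(x : ℂ) * Complex.I‖ = |x| := by simp
    have h := Complex.exp_bound (x := (x : ℂ) * Complex.I) (by rw [hn]; exact hx)
      (n := 3) (by norm_num)
    rw [hn] at h
    have e : ∑ m ∈ Finset.range 3, ((x : ℂ) * Complex.I) ^ m / (m.factorial : ℂ)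
        = 1 + x * Complex.I - (x : ℂ) ^ 2 / 2 := by
      simp [Finset.sum_range_succ, mul_pow, Nat.factorial]
      ring
    rw [e] at h
    have h3 : |x| ^ 3 ≤ |x| ^ 2 := pow_le_pow_of_le_one hx0 hx (by norm_num)
    have hc : ((3 : ℕ).succ * (((3 : ℕ).factorial : ℝ) * (3 : ℕ))⁻¹ : ℝ) ≤ 3 := by
      norm_num [Nat.factorial]
    have h4 := h.trans (mul_le_mul_of_nonneg_left hc (pow_nonneg hx0 3))
    constructor <;> nlinarith
  · have h1 : ‖Complex.exp (x * Complex.I) - 1‖ ≤ |x| := by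
      have := Real.norm_exp_I_mul_ofReal_sub_one_le (x := x)
      rwa [mul_comm, Real.norm_eq_abs] at this
    have e : Complex.exp (x * Complex.I) - (1 + x * Complex.I - (x : ℂ) ^ 2 / 2)
        = (Complex.exp (x * Complex.I) - 1) - x * Complex.I + (x : ℂ) ^ 2 / 2 := by ring
    have hb : ‖Complex.exp (x * Complex.I) - (1 + x * Complex.I - (x : ℂ) ^ 2 / 2)‖
        ≤ |x| + |x| + |x| ^ 2 / 2 := by
      rw [e]
      refine (norm_add_le _ _).trans (add_le_add ((norm_sub_le _ _).trans
        (add_le_add h1 (by simp))) (by simp))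
    have h2 : |x| ≤ |x| ^ 2 := by nlinarith
    have h3 : |x| ^ 2 ≤ |x| ^ 3 := pow_le_pow_right₀ hx (by norm_num)
    constructor <;> nlinarith

/-- Telescoping: factors are exchanged one at a time, and the other factors have norm at most 1. -/
lemma norm_prod_sub_prod_le {ι : Type*} (s : Finset ι) (a b : ι → ℂ)
    (ha : ∀ i ∈ s, ‖a i‖ ≤ 1) (hb : ∀ i ∈ s, ‖b i‖ ≤ 1) :
    ‖∏ i ∈ s, a i - ∏ i ∈ s, b i‖ ≤ ∑ i ∈ s, ‖a i - b i‖ := by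
  classical
  induction s using Finset.induction with
  | empty => simp
  | insert j s hj ih =>
    rw [Finset.prod_insert hj, Finset.prod_insert hj, Finset.sum_insert hj]
    have ha' : ∀ i ∈ s, ‖a i‖ ≤ 1 := fun i hi => ha i (Finset.mem_insert_of_mem hi)
    have hb' : ∀ i ∈ s, ‖b i‖ ≤ 1 := fun i hi => hb i (Finset.mem_insert_of_mem hi)
    have hbj := hb j (Finset.mem_insert_self j s)
    have hpa : ‖∏ i ∈ s, a i‖ ≤ 1 :=
      (Finset.norm_prod_le s a).trans (Finset.prod_le_one (fun i _ => norm_nonneg _) ha')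
    have e : a j * ∏ i ∈ s, a i - b j * ∏ i ∈ s, b i
        = (a j - b j) * ∏ i ∈ s, a i + b j * (∏ i ∈ s, a i - ∏ i ∈ s, b i) := by ring
    rw [e]
    refine (norm_add_le _ _).trans (add_le_add ?_ ?_)
    · rw [norm_mul]
      exact mul_le_of_le_one_right (norm_nonneg _) hpa
    · rw [norm_mul]
      exact (mul_le_of_le_one_left (norm_nonneg _) hbj).trans (ih ha' hb')

lemma abs_exp_neg_sub_le {s : ℝ} (hs : 0 ≤ s) : |Real.exp (-s) - (1 - s)| ≤ s ^ 2 := by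
  rcases le_total s 1 with h | h
  · have := Real.abs_exp_sub_one_sub_id_le (x := -s) (by rwa [abs_neg, abs_of_nonneg hs])
    rw [neg_sq] at this
    convert this using 2
    ring
  · have h1 : Real.exp (-s) ≤ 1 := Real.exp_le_one_iff.2 (by linarith)
    have h2 := Real.exp_pos (-s)
    rw [abs_le]
    constructor <;> nlinarith

variable {Ω : Type*} [MeasurableSpace Ω] {P : Measure Ω} [IsProbabilityMeasure P]

/-- Second order expansion of the characteristic function of a centered square integrable random
variable, with the remainder split at the level `ε`. -/
lemma norm_charFun_sub_le {X : Ω → ℝ} (hX : Measurable X) (h2 : MemLp X 2 P)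
    (h0 : ∫ ω, X ω ∂P = 0) (t : ℝ) {ε : ℝ} (hε : 0 < ε) :
    ‖charFun (P.map X) t - ((1 - (∫ ω, X ω ^ 2 ∂P) * t ^ 2 / 2 : ℝ) : ℂ)‖ ≤
      3 * |t| ^ 3 * ε * ∫ ω, X ω ^ 2 ∂P + 3 * t ^ 2 * ∫ ω in {ω | ε < |X ω|}, X ω ^ 2 ∂P := by
  have hi1 : Integrable X P := h2.integrable (by norm_num)
  have hi2 : Integrable (fun ω => X ω ^ 2) P := h2.integrable_sq
  have hS : MeasurableSet {ω | ε < |X ω|} := measurableSet_lt measurable_const hX.abs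
  have hie : Integrable (fun ω => Complex.exp (t * X ω * Complex.I)) P := by
    refine Integrable.of_bound (C := 1) (by fun_prop) (ae_of_all _ fun ω => ?_)
    have := Complex.norm_exp_ofReal_mul_I (t * X ω)
    push_cast at this
    exact this.le
  have hi3 : Integrable (fun ω => (1 + ((t * X ω : ℝ) : ℂ) * Complex.I
      - ((t * X ω : ℝ) : ℂ) ^ 2 / 2)) P := by
    refine Integrable.sub (Integrable.add (integrable_const _) ?_) ?_
    · exact ((hi1.const_mul t).ofReal).mul_const _
    · refine Integrable.div_const ?_ _
      have h : Integrable (fun ω => (t * X ω) ^ 2) P := by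
        simpa only [mul_pow] using hi2.const_mul (t ^ 2)
      have h' : Integrable (fun ω => (((t * X ω) ^ 2 : ℝ) : ℂ)) P := h.ofReal
      simpa only [Complex.ofReal_pow] using h'
  have e3 : ∫ ω, (1 + ((t * X ω : ℝ) : ℂ) * Complex.I - ((t * X ω : ℝ) : ℂ) ^ 2 / 2) ∂P
      = ((1 - (∫ ω, X ω ^ 2 ∂P) * t ^ 2 / 2 : ℝ) : ℂ) := by
    have e4 : ∀ ω, (1 + ((t * X ω : ℝ) : ℂ) * Complex.I - ((t * X ω : ℝ) : ℂ) ^ 2 / 2)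
        = ((1 - t ^ 2 / 2 * X ω ^ 2 : ℝ) : ℂ) + ((t * X ω : ℝ) : ℂ) * Complex.I := by
      intro ω; push_cast; ring
    simp_rw [e4]
    have hA : Integrable (fun ω => 1 - t ^ 2 / 2 * X ω ^ 2) P :=
      (integrable_const _).sub (hi2.const_mul _)
    rw [integral_add hA.ofReal (((hi1.const_mul t).ofReal).mul_const _), integral_mul_const,
      integral_complex_ofReal, integral_complex_ofReal, integral_const_mul, h0,
      integral_sub (integrable_const _) (hi2.const_mul _), integral_const_mul]
    simp
    ring
  have ec : charFun (P.map X) t = ∫ ω, Complex.exp (t * X ω * Complex.I) ∂P := by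
    rw [charFun_apply_real, integral_map hX.aemeasurable (by fun_prop)]
  rw [ec, ← e3, ← integral_sub hie hi3]
  have hb : ∀ ω, ‖Complex.exp (t * X ω * Complex.I)
      - (1 + ((t * X ω : ℝ) : ℂ) * Complex.I - ((t * X ω : ℝ) : ℂ) ^ 2 / 2)‖
      ≤ 3 * |t| ^ 3 * ε * X ω ^ 2
        + 3 * t ^ 2 * ({ω | ε < |X ω|}.indicator (fun ω => X ω ^ 2) ω) := by
    intro ω
    have := norm_exp_mul_I_sub_le (t * X ω)
    rw [show (t : ℂ) * (X ω : ℂ) = ((t * X ω : ℝ) : ℂ) by push_cast; rfl]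
    by_cases hω : ε < |X ω|
    · rw [Set.indicator_of_mem (by exact hω)]
      have h1 := this.1
      have : 0 ≤ 3 * |t| ^ 3 * ε * X ω ^ 2 := by positivity
      rw [mul_pow] at h1
      linarith
    · rw [Set.indicator_of_notMem (by exact hω)]
      have h1 := this.2
      rw [abs_mul, mul_pow] at h1
      have h2 : |X ω| ^ 3 ≤ ε * X ω ^ 2 := by
        rw [← sq_abs, pow_succ, mul_comm]
        exact mul_le_mul_of_nonneg_right (not_lt.1 hω) (sq_nonneg _)
      have h3 : |t| ^ 3 * |X ω| ^ 3 ≤ |t| ^ 3 * (ε * X ω ^ 2) :=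
        mul_le_mul_of_nonneg_left h2 (by positivity)
      linarith
  refine (norm_integral_le_integral_norm _).trans ?_
  rw [← integral_indicator hS, ← integral_const_mul, ← integral_const_mul,
    ← integral_add (hi2.const_mul _) ((hi2.indicator hS).const_mul _)]
  exact integral_mono (hie.sub hi3).norm
    ((hi2.const_mul _).add ((hi2.indicator hS).const_mul _)) hb

/-- The square integral is at most `ε ^ 2` plus its part above the level `ε`. -/
lemma integral_sq_le_add {X : Ω → ℝ} (hX : Measurable X) (h2 : MemLp X 2 P)
    (ε : ℝ) :
    ∫ ω, X ω ^ 2 ∂P ≤ ε ^ 2 + ∫ ω in {ω | ε < |X ω|}, X ω ^ 2 ∂P := by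
  have hi2 : Integrable (fun ω => X ω ^ 2) P := h2.integrable_sq
  have hS : MeasurableSet {ω | ε < |X ω|} := measurableSet_lt measurable_const hX.abs
  have e : ε ^ 2 = ∫ _, ε ^ 2 ∂P := by simp
  rw [← integral_indicator hS, e, ← integral_add (integrable_const _) (hi2.indicator hS)]
  refine integral_mono hi2 ((integrable_const _).add (hi2.indicator hS)) fun ω => ?_
  by_cases hω : ε < |X ω|
  · simp only [Set.indicator_of_mem (show ω ∈ {ω | ε < |X ω|} from hω)]
    nlinarith [sq_nonneg ε]
  · simp only [Set.indicator_of_notMem (show ω ∉ {ω | ε < |X ω|} from hω), add_zero]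
    rw [← sq_abs]
    exact pow_le_pow_left₀ (abs_nonneg _) (not_lt.1 hω) 2

/-- **Lindeberg's central limit theorem** for triangular arrays with normalized variances. -/
theorem tendstoInDistribution_of_lindeberg {ι : Type*} (s : ℕ → Finset ι) (X : ℕ → ι → Ω → ℝ)
    (hm : ∀ j i, Measurable (X j i)) (hind : ∀ j, iIndepFun (X j) P)
    (h2 : ∀ j i, MemLp (X j i) 2 P) (h0 : ∀ j i, ∫ ω, X j i ω ∂P = 0)
    (h1 : ∀ j, ∑ i ∈ s j, ∫ ω, X j i ω ^ 2 ∂P = 1)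
    (hL : ∀ ε > 0, Tendsto
      (fun j => ∑ i ∈ s j, ∫ ω in {ω | ε < |X j i ω|}, X j i ω ^ 2 ∂P) atTop (𝓝 0)) :
    TendstoInDistribution (fun j ω => ∑ i ∈ s j, X j i ω) atTop id (fun _ => P)
      (gaussianReal 0 1) where
  forall_aemeasurable j := (Finset.measurable_fun_sum _ fun i _ => hm j i).aemeasurable
  tendsto := by
    refine ProbabilityMeasure.tendsto_iff_tendsto_charFun.2 fun t => ?_
    simp only [ProbabilityMeasure.coe_mk, Measure.map_id]
    rw [charFun_gaussianReal]
    -- By Lévy's continuity theorem it suffices to compare characteristic functions, factor by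
    -- factor. The terms with ε come from small values, the last one is the Lindeberg sum.
    have key : ∀ ε > 0, ∀ j, ‖charFun (P.map (fun ω => ∑ i ∈ s j, X j i ω)) t
        - Complex.exp (t * ((0 : ℝ) : ℂ) * Complex.I - (((1 : NNReal) : ℝ) : ℂ) * t ^ 2 / 2)‖
        ≤ (3 * |t| ^ 3 * ε + t ^ 4 * ε ^ 2) + (3 * t ^ 2 + t ^ 4) *
          ∑ i ∈ s j, ∫ ω in {ω | ε < |X j i ω|}, X j i ω ^ 2 ∂P := by
      intro ε hε j
      have hσ0 : ∀ i, 0 ≤ ∫ ω, X j i ω ^ 2 ∂P := fun i => integral_nonneg fun ω => sq_nonneg _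
      have hg0 : ∀ i, 0 ≤ ∫ ω in {ω | ε < |X j i ω|}, X j i ω ^ 2 ∂P :=
        fun i => integral_nonneg fun ω => sq_nonneg _
      rw [((hind j).restrict _).charFun_map_fun_finsetSum_eq_prod
        fun i _ => (hm j i).aemeasurable, Finset.prod_apply]
      -- As the variances add up to 1, the Gaussian characteristic function splits into one factor
      -- per summand with matching variance.
      have eb : Complex.exp (t * ((0 : ℝ) : ℂ) * Complex.I
          - (((1 : NNReal) : ℝ) : ℂ) * t ^ 2 / 2)
          = ∏ i ∈ s j, ((Real.exp (-((∫ ω, X j i ω ^ 2 ∂P) * t ^ 2 / 2)) : ℝ) : ℂ) := by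
        rw [← Complex.ofReal_prod, ← Real.exp_sum, Finset.sum_neg_distrib, ← Finset.sum_div,
          ← Finset.sum_mul, h1 j]
        push_cast
        congr 1
        ring
      rw [eb]
      have hpr : ∀ i, IsProbabilityMeasure (P.map (X j i)) :=
        fun i => Measure.isProbabilityMeasure_map (hm j i).aemeasurable
      refine (norm_prod_sub_prod_le _ _ _ (fun i _ => ?_) (fun i _ => ?_)).trans ?_
      · have := hpr i
        exact norm_charFun_le_one t
      · rw [Complex.norm_real, Real.norm_eq_abs, abs_of_pos (Real.exp_pos _), Real.exp_le_one_iff]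
        have := mul_nonneg (hσ0 i) (sq_nonneg t)
        linarith
      have hterm : ∀ i ∈ s j, ‖charFun (P.map (X j i)) t
          - ((Real.exp (-((∫ ω, X j i ω ^ 2 ∂P) * t ^ 2 / 2)) : ℝ) : ℂ)‖
          ≤ (3 * |t| ^ 3 * ε) * ∫ ω, X j i ω ^ 2 ∂P
            + 3 * t ^ 2 * ∫ ω in {ω | ε < |X j i ω|}, X j i ω ^ 2 ∂P
            + t ^ 4 * (ε ^ 2 + ∑ i ∈ s j, ∫ ω in {ω | ε < |X j i ω|}, X j i ω ^ 2 ∂P)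
              * ∫ ω, X j i ω ^ 2 ∂P := by
        intro i hi
        have ha := norm_charFun_sub_le (hm j i) (h2 j i) (h0 j i) t hε
        have hsn : 0 ≤ (∫ ω, X j i ω ^ 2 ∂P) * t ^ 2 / 2 := by
          have := mul_nonneg (hσ0 i) (sq_nonneg t)
          linarith
        have hb := abs_exp_neg_sub_le hsn
        have hb' : ‖((1 - (∫ ω, X j i ω ^ 2 ∂P) * t ^ 2 / 2 : ℝ) : ℂ)
            - ((Real.exp (-((∫ ω, X j i ω ^ 2 ∂P) * t ^ 2 / 2)) : ℝ) : ℂ)‖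
            ≤ ((∫ ω, X j i ω ^ 2 ∂P) * t ^ 2 / 2) ^ 2 := by
          rw [← Complex.ofReal_sub, Complex.norm_real, Real.norm_eq_abs, abs_sub_comm]
          exact hb
        have hc := integral_sq_le_add (hm j i) (h2 j i) ε
        have hd : ∫ ω in {ω | ε < |X j i ω|}, X j i ω ^ 2 ∂P
            ≤ ∑ i ∈ s j, ∫ ω in {ω | ε < |X j i ω|}, X j i ω ^ 2 ∂P :=
          Finset.single_le_sum (f := fun i => ∫ ω in {ω | ε < |X j i ω|}, X j i ω ^ 2 ∂P)
            (fun i _ => hg0 i) hi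
        -- One factor σᵢ² of the square is bounded uniformly in i by ε² plus the Lindeberg sum; the
        -- other is kept, to be summed to 1.
        have he : ((∫ ω, X j i ω ^ 2 ∂P) * t ^ 2 / 2) ^ 2
            ≤ t ^ 4 * (ε ^ 2 + ∑ i ∈ s j, ∫ ω in {ω | ε < |X j i ω|}, X j i ω ^ 2 ∂P)
              * ∫ ω, X j i ω ^ 2 ∂P := by
          have h5 := mul_le_mul_of_nonneg_right (hc.trans (add_le_add_right hd (ε ^ 2))) (hσ0 i)
          have h6 := mul_le_mul_of_nonneg_left h5 (by positivity : 0 ≤ t ^ 4)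
          have h7 : 0 ≤ t ^ 4 * ((∫ ω, X j i ω ^ 2 ∂P) * ∫ ω, X j i ω ^ 2 ∂P) :=
            mul_nonneg (by positivity) (mul_nonneg (hσ0 i) (hσ0 i))
          nlinarith
        have hf := (norm_sub_le_norm_sub_add_norm_sub (charFun (P.map (X j i)) t)
          ((1 - (∫ ω, X j i ω ^ 2 ∂P) * t ^ 2 / 2 : ℝ) : ℂ)
          ((Real.exp (-((∫ ω, X j i ω ^ 2 ∂P) * t ^ 2 / 2)) : ℝ) : ℂ))
        linarith
      refine (Finset.sum_le_sum hterm).trans (le_of_eq ?_)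
      rw [Finset.sum_add_distrib, Finset.sum_add_distrib, ← Finset.mul_sum, ← Finset.mul_sum,
        ← Finset.mul_sum, h1 j]
      ring
    rw [tendsto_iff_norm_sub_tendsto_zero]
    rw [Metric.tendsto_atTop]
    intro δ hδ
    obtain ⟨ε, hε, hεδ⟩ : ∃ ε > 0, 3 * |t| ^ 3 * ε + t ^ 4 * ε ^ 2 < δ / 2 := by
      have hc : Tendsto (fun ε : ℝ => 3 * |t| ^ 3 * ε + t ^ 4 * ε ^ 2) (𝓝[>] 0) (𝓝 0) := by
        have : Continuous (fun ε : ℝ => 3 * |t| ^ 3 * ε + t ^ 4 * ε ^ 2) := by fun_prop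
        have := this.tendsto 0
        simp only [mul_zero, ne_eq, OfNat.ofNat_ne_zero, not_false_eq_true, zero_pow,
          add_zero] at this
        exact this.mono_left nhdsWithin_le_nhds
      obtain ⟨ε, h, h'⟩ := ((hc.eventually_lt_const (half_pos hδ)).and
        self_mem_nhdsWithin).exists
      exact ⟨ε, h', h⟩
    have hlim := (hL ε hε).const_mul (3 * t ^ 2 + t ^ 4)
    rw [mul_zero] at hlim
    obtain ⟨N, hN⟩ := eventually_atTop.1 (hlim.eventually_lt_const (half_pos hδ))
    refine ⟨N, fun j hj => ?_⟩
    rw [Real.dist_eq, sub_zero, abs_of_nonneg (norm_nonneg _)]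
    have := key ε hε j
    have := hN j hj
    linarith

end MultiGroup

/-! ### Centered samples and groups. -/

namespace MultiGroup

variable {Ω : Type*} [MeasurableSpace Ω] {P : Measure Ω}

/-- An independent and identically distributed sequence of centered random variables with a
finite fourth moment. -/
structure CenteredSample (P : Measure Ω) (X : ℕ → Ω → ℝ) : Prop where
  measurable : ∀ k, Measurable (X k)
  indep : iIndepFun X P
  ident : ∀ k, IdentDistrib (X k) (X 0) P P
  memLp_zero : MemLp (X 0) 4 P
  integral_zero : ∫ ω, X 0 ω ∂P = 0

namespace CenteredSample

variable {X : ℕ → Ω → ℝ}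

lemma memLp (h : CenteredSample P X) (k : ℕ) : MemLp (X k) 4 P :=
  (h.ident k).memLp_iff.2 h.memLp_zero

lemma integral_eq_zero (h : CenteredSample P X) (k : ℕ) : ∫ ω, X k ω ∂P = 0 := by
  rw [(h.ident k).integral_eq, h.integral_zero]

lemma integral_pow (h : CenteredSample P X) (k p : ℕ) : ∫ ω, X k ω ^ p ∂P = ∫ ω, X 0 ω ^ p ∂P :=
  ((h.ident k).comp (u := fun x => x ^ p) (by fun_prop)).integral_eq

lemma memLp_sum (h : CenteredSample P X) (n : ℕ) :
    MemLp (fun ω => ∑ k ∈ Finset.range n, X k ω) 4 P :=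
  memLp_finsetSum _ fun k _ => h.memLp k

end CenteredSample

/-- Independent groups of independent, centered observations, identically distributed within each
group and with finite fourth moments. -/
structure CenteredGroups (P : Measure Ω) (D : ℕ → ℕ → Ω → ℝ) : Prop where
  measurable : ∀ i k, Measurable (D i k)
  indep : iIndepFun (fun p : ℕ × ℕ => D p.1 p.2) P
  ident : ∀ i k, IdentDistrib (D i k) (D i 0) P P
  memLp_zero : ∀ i, MemLp (D i 0) 4 P
  integral_zero : ∀ i, ∫ ω, D i 0 ω ∂P = 0

/-- The second moment of the `i`-th group. -/
noncomputable def groupSecond (P : Measure Ω) (D : ℕ → ℕ → Ω → ℝ) (i : ℕ) : ℝ := ∫ ω, D i 0 ω ^ 2 ∂P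

/-- The fourth moment of the `i`-th group. -/
noncomputable def groupFourth (P : Measure Ω) (D : ℕ → ℕ → Ω → ℝ) (i : ℕ) : ℝ := ∫ ω, D i 0 ω ^ 4 ∂P

/-- The part of the fourth moment of the `i`-th group above the level `M`. -/
noncomputable def groupTail (P : Measure Ω) (D : ℕ → ℕ → Ω → ℝ) (M : ℝ) (i : ℕ) : ℝ :=
  ∫ ω in {ω | M < D i 0 ω ^ 4}, D i 0 ω ^ 4 ∂P

/-- The sum over the first `L` groups of (fourth moment) - (second moment)². -/
noncomputable def groupExcess (P : Measure Ω) (D : ℕ → ℕ → Ω → ℝ) (L : ℕ) : ℝ :=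
  ∑ i ∈ Finset.range L, (groupFourth P D i - groupSecond P D i ^ 2)

namespace CenteredGroups

variable {D : ℕ → ℕ → Ω → ℝ}

lemma sample (h : CenteredGroups P D) (i : ℕ) : CenteredSample P (D i) where
  measurable := h.measurable i
  indep := h.indep.precomp (g := fun k : ℕ => (i, k)) fun _ _ hab => (Prod.mk.inj hab).2
  ident := h.ident i
  memLp_zero := h.memLp_zero i
  integral_zero := h.integral_zero i

lemma groupFourth_nonneg (i : ℕ) : 0 ≤ groupFourth P D i :=
  integral_nonneg fun ω => by positivity

lemma groupSecond_nonneg (i : ℕ) : 0 ≤ groupSecond P D i :=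
  integral_nonneg fun ω => by positivity

lemma setIntegral_tail (h : CenteredGroups P D) (i k : ℕ) (M : ℝ) :
    ∫ ω in {ω | M < D i k ω ^ 4}, D i k ω ^ 4 ∂P = groupTail P D M i := by
  have hm : ∀ k, MeasurableSet {ω | M < D i k ω ^ 4} := fun k =>
    measurableSet_lt measurable_const ((h.measurable i k).pow_const 4)
  have hu : Measurable ({x : ℝ | M < x ^ 4}.indicator fun x => x ^ 4) :=
    (measurable_id.pow_const 4).indicator
      (measurableSet_lt measurable_const (measurable_id.pow_const 4))
  rw [groupTail, ← integral_indicator (hm k), ← integral_indicator (hm 0)]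
  exact ((h.ident i k).comp hu).integral_eq

/-- The two sums are functions of disjoint blocks {i} × [0, n) and {j} × [0, n) of one independent
family. -/
lemma indepFun_sum (h : CenteredGroups P D) (n : ℕ) {i j : ℕ} (hij : i ≠ j) :
    (fun ω => ∑ k ∈ Finset.range n, D i k ω) ⟂ᵢ[P]
      (fun ω => ∑ k ∈ Finset.range n, D j k ω) := by
  have hd : Disjoint (({i} : Finset ℕ) ×ˢ Finset.range n) (({j} : Finset ℕ) ×ˢ Finset.range n) :=
    Finset.disjoint_product.2 (Or.inl (by simpa using hij))
  have hI := h.indep.indepFun_finset _ _ hd fun p => h.measurable p.1 p.2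
  have hI' := hI.comp (φ := fun f => ∑ p, f p) (ψ := fun f => ∑ p, f p) (by fun_prop)
    (by fun_prop)
  have e : ∀ l : ℕ, (fun f : (({l} : Finset ℕ) ×ˢ Finset.range n : Finset (ℕ × ℕ)) → ℝ =>
      ∑ p, f p) ∘ (fun a (p : (({l} : Finset ℕ) ×ˢ Finset.range n : Finset (ℕ × ℕ))) =>
        D (p : ℕ × ℕ).1 (p : ℕ × ℕ).2 a) = fun ω => ∑ k ∈ Finset.range n, D l k ω := by
    intro l
    ext ω
    simp only [Function.comp_apply]
    rw [Finset.sum_coe_sort (({l} : Finset ℕ) ×ˢ Finset.range n) fun p => D p.1 p.2 ω,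
      Finset.sum_product]
    simp
  rw [e, e] at hI'
  exact hI'

end CenteredGroups

end MultiGroup

/-! ### Moment bounds within one group. -/

namespace MultiGroup

variable {Ω : Type*} [MeasurableSpace Ω] {P : Measure Ω} [IsProbabilityMeasure P]

lemma integrable_pow_of_memLp {f : Ω → ℝ} {p : ℕ} (h : MemLp f p P) {k : ℕ} (hk : k ≤ p) :
    Integrable (fun ω => f ω ^ k) P := by
  have h' : MemLp f k P := h.mono_exponent (by exact_mod_cast hk)
  refine h'.integrable_norm_pow'.mono (h.aestronglyMeasurable.pow k) (ae_of_all _ fun ω => ?_)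
  simp

lemma memLp_two_sq {f : Ω → ℝ} (h : MemLp f 4 P) : MemLp (fun ω => f ω ^ 2) 2 P := by
  refine (memLp_two_iff_integrable_sq (h.aestronglyMeasurable.pow 2)).2 ?_
  have := integrable_pow_of_memLp (p := 4) (by exact_mod_cast h) le_rfl
  simpa [← pow_mul] using this

lemma integral_sum_sq_of_pairwise {ι : Type*} (s : Finset ι) (Z : ι → Ω → ℝ)
    (h2 : ∀ i ∈ s, MemLp (Z i) 2 P) (hind : Set.Pairwise ↑s fun i j => Z i ⟂ᵢ[P] Z j)
    (h0 : ∀ i ∈ s, ∫ ω, Z i ω ∂P = 0) :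
    ∫ ω, (∑ i ∈ s, Z i ω) ^ 2 ∂P = ∑ i ∈ s, ∫ ω, Z i ω ^ 2 ∂P := by
  have h := IndepFun.variance_sum h2 hind
  rw [variance_of_integral_eq_zero (memLp_finsetSum' s h2).aemeasurable] at h
  · simp only [Finset.sum_apply] at h
    rw [h]
    exact Finset.sum_congr rfl fun i hi =>
      variance_of_integral_eq_zero (h2 i hi).aemeasurable (h0 i hi)
  · simp only [Finset.sum_apply]
    rw [integral_finsetSum _ fun i hi => (h2 i hi).integrable (by norm_num)]
    exact Finset.sum_eq_zero h0

lemma sq_integral_sq_le {f : Ω → ℝ} (h : MemLp f 4 P) :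
    (∫ ω, f ω ^ 2 ∂P) ^ 2 ≤ ∫ ω, f ω ^ 4 ∂P := by
  have h1 := variance_nonneg (fun ω => f ω ^ 2) P
  rw [variance_eq_sub (memLp_two_sq h)] at h1
  simp only [Pi.pow_apply, ← pow_mul] at h1
  norm_num at h1
  linarith

/-- In the binomial expansion the mixed terms with exponents (3,1) and (1,3) vanish, since each
contains a mean. -/
lemma integral_add_pow_four {S X : Ω → ℝ} (hS : MemLp S 4 P) (hX : MemLp X 4 P)
    (hind : S ⟂ᵢ[P] X) (hS0 : ∫ ω, S ω ∂P = 0) (hX0 : ∫ ω, X ω ∂P = 0) :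
    ∫ ω, (S ω + X ω) ^ 4 ∂P = ∫ ω, S ω ^ 4 ∂P
      + 6 * ((∫ ω, S ω ^ 2 ∂P) * ∫ ω, X ω ^ 2 ∂P) + ∫ ω, X ω ^ 4 ∂P := by
  have iS : ∀ k ≤ 4, Integrable (fun ω => S ω ^ k) P :=
    fun k hk => integrable_pow_of_memLp (p := 4) (by exact_mod_cast hS) hk
  have iX : ∀ k ≤ 4, Integrable (fun ω => X ω ^ k) P :=
    fun k hk => integrable_pow_of_memLp (p := 4) (by exact_mod_cast hX) hk
  have hI : ∀ a b : ℕ, (fun ω => S ω ^ a) ⟂ᵢ[P] (fun ω => X ω ^ b) := fun a b =>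
    hind.comp (φ := fun x => x ^ a) (ψ := fun x => x ^ b) (by fun_prop) (by fun_prop)
  have iM : ∀ a b : ℕ, a ≤ 4 → b ≤ 4 → Integrable (fun ω => S ω ^ a * X ω ^ b) P :=
    fun a b ha hb => (hI a b).integrable_mul (iS a ha) (iX b hb)
  have eM : ∀ a b : ℕ, a ≤ 4 → b ≤ 4 → ∫ ω, S ω ^ a * X ω ^ b ∂P
      = (∫ ω, S ω ^ a ∂P) * ∫ ω, X ω ^ b ∂P := fun a b ha hb =>
    (hI a b).integral_fun_mul_eq_mul_integral (iS a ha).aestronglyMeasurable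
      (iX b hb).aestronglyMeasurable
  have e : ∀ ω, (S ω + X ω) ^ 4 = S ω ^ 4 + 4 * (S ω ^ 3 * X ω ^ 1) + 6 * (S ω ^ 2 * X ω ^ 2)
      + 4 * (S ω ^ 1 * X ω ^ 3) + X ω ^ 4 := fun ω => by ring
  simp_rw [e]
  have i1 := iS 4 le_rfl
  have i2 := (iM 3 1 (by norm_num) (by norm_num)).const_mul 4
  have i3 := (iM 2 2 (by norm_num) (by norm_num)).const_mul 6
  have i4 := (iM 1 3 (by norm_num) (by norm_num)).const_mul 4
  have i5 := iX 4 le_rfl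
  have i12 : Integrable (fun ω => S ω ^ 4 + 4 * (S ω ^ 3 * X ω ^ 1)) P := i1.add i2
  have i123 : Integrable (fun ω => S ω ^ 4 + 4 * (S ω ^ 3 * X ω ^ 1)
      + 6 * (S ω ^ 2 * X ω ^ 2)) P := i12.add i3
  have i1234 : Integrable (fun ω => S ω ^ 4 + 4 * (S ω ^ 3 * X ω ^ 1)
      + 6 * (S ω ^ 2 * X ω ^ 2) + 4 * (S ω ^ 1 * X ω ^ 3)) P := i123.add i4
  rw [integral_add i1234 i5, integral_add i123 i4, integral_add i12 i3, integral_add i1 i2]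
  simp only [integral_const_mul]
  rw [eM 3 1 (by norm_num) (by norm_num), eM 2 2 (by norm_num) (by norm_num),
    eM 1 3 (by norm_num) (by norm_num)]
  simp only [pow_one, hS0, hX0]
  ring

namespace CenteredSample

variable {X : ℕ → Ω → ℝ}

lemma integrable_sum_pow (h : CenteredSample P X) (n : ℕ) {p : ℕ} (hp : p ≤ 4) :
    Integrable (fun ω => (∑ k ∈ Finset.range n, X k ω) ^ p) P :=
  integrable_pow_of_memLp (p := 4) (by exact_mod_cast h.memLp_sum n) hp

lemma integrable_pow (h : CenteredSample P X) (k : ℕ) {p : ℕ} (hp : p ≤ 4) :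
    Integrable (fun ω => X k ω ^ p) P :=
  integrable_pow_of_memLp (p := 4) (by exact_mod_cast h.memLp k) hp

lemma integral_sum (h : CenteredSample P X) (n : ℕ) : ∫ ω, ∑ k ∈ Finset.range n, X k ω ∂P = 0 := by
  rw [integral_finsetSum _ fun k _ => (h.memLp k).integrable (by norm_num)]
  exact Finset.sum_eq_zero fun k _ => h.integral_eq_zero k

lemma integral_sum_sq (h : CenteredSample P X) (n : ℕ) :
    ∫ ω, (∑ k ∈ Finset.range n, X k ω) ^ 2 ∂P = n * ∫ ω, X 0 ω ^ 2 ∂P := by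
  rw [integral_sum_sq_of_pairwise _ _ (fun k _ => (h.memLp k).mono_exponent (by norm_num))
    (fun i _ j _ hij => h.indep.indepFun hij) fun k _ => h.integral_eq_zero k]
  simp [h.integral_pow]

/-- The new observation adds 6nv² + μ₄, where v² ≤ μ₄, and this is at most 3((n+1)² - n²)μ₄. -/
lemma integral_sum_pow_four_le (h : CenteredSample P X) (n : ℕ) :
    ∫ ω, (∑ k ∈ Finset.range n, X k ω) ^ 4 ∂P ≤ 3 * n ^ 2 * ∫ ω, X 0 ω ^ 4 ∂P := by
  induction n with
  | zero => simp
  | succ n ih =>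
    simp only [Finset.sum_range_succ]
    have hi := h.indep.indepFun_sum_range_succ h.measurable n
    have e : (∑ j ∈ Finset.range n, X j) = fun ω => ∑ k ∈ Finset.range n, X k ω := by
      ext ω; simp
    rw [e] at hi
    rw [integral_add_pow_four (h.memLp_sum n) (h.memLp n) hi (h.integral_sum n)
      (h.integral_eq_zero n), h.integral_sum_sq, h.integral_pow n 2, h.integral_pow n 4]
    have := sq_integral_sq_le h.memLp_zero
    have hn : (0 : ℝ) ≤ n := n.cast_nonneg
    have h4 : 0 ≤ ∫ ω, X 0 ω ^ 4 ∂P := integral_nonneg fun ω => by positivity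
    push_cast
    nlinarith [mul_le_mul_of_nonneg_left this hn]

lemma integral_sum_sq_div_sub_sq_le (h : CenteredSample P X) {n : ℕ} (hn : 0 < n) :
    ∫ ω, ((∑ k ∈ Finset.range n, X k ω) ^ 2 / n - ∫ ω', X 0 ω' ^ 2 ∂P) ^ 2 ∂P
      ≤ 3 * ∫ ω, X 0 ω ^ 4 ∂P := by
  have hn' : (0 : ℝ) < n := by exact_mod_cast hn
  set v := ∫ ω', X 0 ω' ^ 2 ∂P
  have e : ∀ ω, ((∑ k ∈ Finset.range n, X k ω) ^ 2 / n - v) ^ 2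
      = ((n : ℝ) ^ 2)⁻¹ * (∑ k ∈ Finset.range n, X k ω) ^ 4
        - (2 * v / n) * (∑ k ∈ Finset.range n, X k ω) ^ 2 + v ^ 2 := by
    intro ω; field_simp; ring
  simp_rw [e]
  have i4 := (h.integrable_sum_pow n (p := 4) le_rfl).const_mul ((n : ℝ) ^ 2)⁻¹
  have i2 := (h.integrable_sum_pow n (p := 2) (by norm_num)).const_mul (2 * v / n)
  have i42 : Integrable (fun ω => ((n : ℝ) ^ 2)⁻¹ * (∑ k ∈ Finset.range n, X k ω) ^ 4
      - (2 * v / n) * (∑ k ∈ Finset.range n, X k ω) ^ 2) P := i4.sub i2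
  rw [integral_add i42 (integrable_const _), integral_sub i4 i2, integral_const_mul,
    integral_const_mul, h.integral_sum_sq]
  have h4 := mul_le_mul_of_nonneg_left (h.integral_sum_pow_four_le n)
    (by positivity : 0 ≤ ((n : ℝ) ^ 2)⁻¹)
  have e1 : ((n : ℝ) ^ 2)⁻¹ * (3 * n ^ 2 * ∫ ω, X 0 ω ^ 4 ∂P) = 3 * ∫ ω, X 0 ω ^ 4 ∂P := by
    field_simp
  have e2 : 2 * v / n * (n * v) = 2 * v ^ 2 := by field_simp
  rw [e1] at h4
  simp only [integral_const, probReal_univ, one_smul]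
  have e3 : 2 * v / n * (n * ∫ ω, X 0 ω ^ 2 ∂P) = 2 * v ^ 2 := e2
  rw [e3]
  nlinarith [sq_nonneg v]

lemma memLp_sq_sub (h : CenteredSample P X) (k : ℕ) :
    MemLp (fun ω => X k ω ^ 2 - ∫ ω', X 0 ω' ^ 2 ∂P) 2 P :=
  (memLp_two_sq (h.memLp k)).sub (memLp_const _)

lemma integral_sq_sub (h : CenteredSample P X) (k : ℕ) :
    ∫ ω, (X k ω ^ 2 - ∫ ω', X 0 ω' ^ 2 ∂P) ∂P = 0 := by
  rw [integral_sub (h.integrable_pow k (by norm_num)) (integrable_const _), h.integral_pow]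
  simp

lemma integral_sq_sub_sq (h : CenteredSample P X) (k : ℕ) :
    ∫ ω, (X k ω ^ 2 - ∫ ω', X 0 ω' ^ 2 ∂P) ^ 2 ∂P
    = ∫ ω, X 0 ω ^ 4 ∂P - (∫ ω, X 0 ω ^ 2 ∂P) ^ 2 := by
  set v := ∫ ω', X 0 ω' ^ 2 ∂P
  have e : ∀ ω, (X k ω ^ 2 - v) ^ 2 = X k ω ^ 4 - 2 * v * X k ω ^ 2 + v ^ 2 := fun ω => by ring
  simp_rw [e]
  have i4 := h.integrable_pow k (p := 4) le_rfl
  have i2 := (h.integrable_pow k (p := 2) (by norm_num)).const_mul (2 * v)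
  have i42 : Integrable (fun ω => X k ω ^ 4 - 2 * v * X k ω ^ 2) P := i4.sub i2
  rw [integral_add i42 (integrable_const _), integral_sub i4 i2, integral_const_mul,
    h.integral_pow k 4, h.integral_pow k 2]
  simp only [integral_const, probReal_univ, one_smul]
  change _ - 2 * v * v + v ^ 2 = _
  ring

lemma integral_sum_sq_sub_sq (h : CenteredSample P X) (n : ℕ) :
    ∫ ω, (∑ k ∈ Finset.range n, (X k ω ^ 2 - ∫ ω', X 0 ω' ^ 2 ∂P)) ^ 2 ∂P
      = n * (∫ ω, X 0 ω ^ 4 ∂P - (∫ ω, X 0 ω ^ 2 ∂P) ^ 2) := by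
  rw [integral_sum_sq_of_pairwise _ (fun k ω => X k ω ^ 2 - ∫ ω', X 0 ω' ^ 2 ∂P)
    (fun k _ => h.memLp_sq_sub k) _ fun k _ => h.integral_sq_sub k]
  · simp only [h.integral_sq_sub_sq, Finset.sum_const, Finset.card_range, nsmul_eq_mul]
  · intro i _ j _ hij
    exact (h.indep.indepFun hij).comp (φ := fun x => x ^ 2 - ∫ ω', X 0 ω' ^ 2 ∂P)
      (ψ := fun x => x ^ 2 - ∫ ω', X 0 ω' ^ 2 ∂P) (by fun_prop) (by fun_prop)

end CenteredSample

lemma sum_sub_sampleMean_sq {n : ℕ} (hn : 0 < n) (x : ℕ → ℝ) :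
    ∑ k ∈ Finset.range n, (x k - sampleMean n x) ^ 2
      = ∑ k ∈ Finset.range n, x k ^ 2 - (∑ k ∈ Finset.range n, x k) ^ 2 / n := by
  have hn' : (n : ℝ) ≠ 0 := by exact_mod_cast hn.ne'
  have e : ∀ k, (x k - sampleMean n x) ^ 2
      = x k ^ 2 - 2 * sampleMean n x * x k + sampleMean n x ^ 2 := fun k => by ring
  simp_rw [e]
  rw [Finset.sum_add_distrib, Finset.sum_sub_distrib, ← Finset.mul_sum]
  simp only [Finset.sum_const, Finset.card_range, nsmul_eq_mul, sampleMean]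
  field_simp
  ring

/-- Writing (n-1)v = nv - v makes both parts centered when v is the variance of centered
observations: the first drives the limit law, the second is a remainder bounded in L². -/
lemma sampleVariance_sub {n : ℕ} (hn : 2 ≤ n) (x : ℕ → ℝ) (v : ℝ) :
    sampleVariance n x - v = (∑ k ∈ Finset.range n, (x k ^ 2 - v)
      - ((∑ k ∈ Finset.range n, x k) ^ 2 / n - v)) / ((n : ℝ) - 1) := by
  have hn' : (2 : ℝ) ≤ n := by exact_mod_cast hn
  have h1 : (n : ℝ) - 1 ≠ 0 := by linarith
  rw [sampleVariance, sum_sub_sampleMean_sq (by omega), Finset.sum_sub_distrib]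
  simp only [Finset.sum_const, Finset.card_range, nsmul_eq_mul]
  rw [eq_div_iff h1, sub_mul, div_mul_cancel₀ _ h1]
  ring

/-- The constant is 4 + 6 + 4 + 1: each mixed monomial is at most x⁴ + b⁴, and all but one of the
powers of r are discarded. -/
lemma abs_sub_mul_pow_four_le (x b : ℝ) {r : ℝ} (hr : 0 ≤ r) (hr1 : r ≤ 1) :
    |(x - r * b) ^ 4 - x ^ 4| ≤ 15 * r * (x ^ 4 + b ^ 4) := by
  have hx := abs_nonneg x
  have hb := abs_nonneg b
  have ex : x ^ 4 = |x| ^ 4 := by rw [← abs_pow, abs_of_nonneg (by positivity : (0 : ℝ) ≤ x ^ 4)]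
  have eb : b ^ 4 = |b| ^ 4 := by rw [← abs_pow, abs_of_nonneg (by positivity : (0 : ℝ) ≤ b ^ 4)]
  have e : (x - r * b) ^ 4 - x ^ 4
      = r * (-4 * (x ^ 3 * b) + 6 * r * (x ^ 2 * b ^ 2) - 4 * r ^ 2 * (x * b ^ 3)
        + r ^ 3 * b ^ 4) := by
    ring
  have h31 : |x| ^ 3 * |b| ≤ |x| ^ 4 + |b| ^ 4 := by
    rcases le_total |x| |b| with h | h
    · have := mul_le_mul_of_nonneg_right (pow_le_pow_left₀ hx h 3) hb
      nlinarith [pow_nonneg hx 4]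
    · have := mul_le_mul_of_nonneg_left h (pow_nonneg hx 3)
      nlinarith [pow_nonneg hb 4]
  have h13 : |x| * |b| ^ 3 ≤ |x| ^ 4 + |b| ^ 4 := by
    rcases le_total |b| |x| with h | h
    · have := mul_le_mul_of_nonneg_left (pow_le_pow_left₀ hb h 3) hx
      nlinarith [pow_nonneg hb 4]
    · have := mul_le_mul_of_nonneg_right h (pow_nonneg hb 3)
      nlinarith [pow_nonneg hx 4]
  have h22 : |x| ^ 2 * |b| ^ 2 ≤ |x| ^ 4 + |b| ^ 4 := by
    nlinarith [sq_nonneg (|x| ^ 2 - |b| ^ 2), pow_nonneg hx 4, pow_nonneg hb 4]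
  rw [e, abs_mul, abs_of_nonneg hr, ex]
  have hr2 : r ^ 2 ≤ 1 := pow_le_one₀ hr hr1
  have hr3 : r ^ 3 ≤ 1 := pow_le_one₀ hr hr1
  have t : |-4 * (x ^ 3 * b) + 6 * r * (x ^ 2 * b ^ 2) - 4 * r ^ 2 * (x * b ^ 3) + r ^ 3 * b ^ 4|
      ≤ 4 * (|x| ^ 3 * |b|) + 6 * r * (|x| ^ 2 * |b| ^ 2) + 4 * r ^ 2 * (|x| * |b| ^ 3)
        + r ^ 3 * |b| ^ 4 := by
    refine (abs_add_le _ _).trans (add_le_add ((abs_sub _ _).trans (add_le_add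
      ((abs_add_le _ _).trans (add_le_add ?_ ?_)) ?_)) ?_) <;>
      simp [abs_mul, abs_of_nonneg hr]
  have a2 : 6 * r * (|x| ^ 2 * |b| ^ 2) ≤ 6 * (|x| ^ 4 + |b| ^ 4) := by
    have := mul_le_of_le_one_left (by positivity : 0 ≤ |x| ^ 2 * |b| ^ 2) hr1
    linarith
  have a3 : 4 * r ^ 2 * (|x| * |b| ^ 3) ≤ 4 * (|x| ^ 4 + |b| ^ 4) := by
    have := mul_le_of_le_one_left (by positivity : 0 ≤ |x| * |b| ^ 3) hr2
    linarith
  have a4 : r ^ 3 * |b| ^ 4 ≤ |x| ^ 4 + |b| ^ 4 := by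
    have := mul_le_of_le_one_left (by positivity : 0 ≤ |b| ^ 4) hr3
    have := pow_nonneg hx 4
    linarith
  have : |-4 * (x ^ 3 * b) + 6 * r * (x ^ 2 * b ^ 2) - 4 * r ^ 2 * (x * b ^ 3) + r ^ 3 * b ^ 4|
      ≤ 15 * (|x| ^ 4 + |b| ^ 4) := by linarith
  have := mul_le_mul_of_nonneg_left this hr
  rw [eb] at this ⊢
  linarith

lemma abs_sampleFourthMoment_sub_le {n : ℕ} (hn : 0 < n) (x : ℕ → ℝ) :
    |sampleFourthMoment n x - (∑ k ∈ Finset.range n, x k ^ 4) / n|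
      ≤ 15 / √n * ((∑ k ∈ Finset.range n, x k ^ 4) / n
        + (∑ k ∈ Finset.range n, x k) ^ 4 / n ^ 2) := by
  have hn' : (0 : ℝ) < n := by exact_mod_cast hn
  have hs : 0 < √(n : ℝ) := Real.sqrt_pos.2 hn'
  have hss : √(n : ℝ) ^ 2 = n := Real.sq_sqrt hn'.le
  have hs1 : 1 ≤ √(n : ℝ) := Real.one_le_sqrt.2 (by exact_mod_cast hn)
  -- The mean is r·b with r = 1/√n small and b the sum over √n, whose fourth moment stays bounded
  -- for a centered sample.
  have em : sampleMean n x = (√(n : ℝ))⁻¹ * ((∑ k ∈ Finset.range n, x k) / √(n : ℝ)) := by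
    rw [sampleMean]
    field_simp
    rw [hss]
  have eb : ((∑ k ∈ Finset.range n, x k) / √(n : ℝ)) ^ 4
      = (∑ k ∈ Finset.range n, x k) ^ 4 / n ^ 2 := by
    rw [div_pow]
    congr 1
    rw [← hss]
    ring_nf
    rw [hss]
  rw [sampleFourthMoment, ← sub_div, ← Finset.sum_sub_distrib, abs_div, abs_of_pos hn',
    div_le_iff₀ hn']
  refine (Finset.abs_sum_le_sum_abs _ _).trans ?_
  have hk : ∀ k ∈ Finset.range n, |(x k - sampleMean n x) ^ 4 - x k ^ 4|
      ≤ 15 * (√(n : ℝ))⁻¹ * (x k ^ 4 + (∑ k ∈ Finset.range n, x k) ^ 4 / n ^ 2) := by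
    intro k _
    rw [← eb, em]
    exact abs_sub_mul_pow_four_le _ _ (by positivity) (inv_le_one_of_one_le₀ hs1)
  refine (Finset.sum_le_sum hk).trans (le_of_eq ?_)
  rw [← Finset.mul_sum, Finset.sum_add_distrib]
  simp only [Finset.sum_const, Finset.card_range, nsmul_eq_mul]
  field_simp

/-- From a² - v² = (a-v)² + 2v(a-v) and a weighted AM-GM inequality. The later choice s = √n
balances a mean square error of order 1/n against v²/√n. -/
lemma abs_sq_sub_sq_le {s : ℝ} (hs : 0 < s) (a v : ℝ) :
    |a ^ 2 - v ^ 2| ≤ (1 + s) * (a - v) ^ 2 + v ^ 2 / s := by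
  have e : v ^ 2 / s * s = v ^ 2 := div_mul_cancel₀ _ hs.ne'
  have h1 : 0 ≤ s * (s * (a - v) ^ 2 + v ^ 2 / s + 2 * v * (a - v)) := by
    nlinarith [sq_nonneg (s * (a - v) + v)]
  have h2 : 0 ≤ s * (s * (a - v) ^ 2 + v ^ 2 / s - 2 * v * (a - v)) := by
    nlinarith [sq_nonneg (s * (a - v) - v)]
  have h1' := nonneg_of_mul_nonneg_right h1 hs
  have h2' := nonneg_of_mul_nonneg_right h2 hs
  rw [abs_le]
  constructor <;> nlinarith [sq_nonneg (a - v)]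

lemma measurable_sampleVariance {X : ℕ → Ω → ℝ} (hX : ∀ k, Measurable (X k)) (n : ℕ) :
    Measurable (fun ω => sampleVariance n (fun k => X k ω)) := by
  unfold sampleVariance sampleMean
  fun_prop

lemma measurable_sampleFourthMoment {X : ℕ → Ω → ℝ} (hX : ∀ k, Measurable (X k)) (n : ℕ) :
    Measurable (fun ω => sampleFourthMoment n (fun k => X k ω)) := by
  unfold sampleFourthMoment sampleMean
  fun_prop

namespace CenteredSample

variable {X : ℕ → Ω → ℝ}

lemma memLp_sum_sq_div_sub (h : CenteredSample P X) (n : ℕ) :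
    MemLp (fun ω => (∑ k ∈ Finset.range n, X k ω) ^ 2 / n - ∫ ω', X 0 ω' ^ 2 ∂P) 2 P := by
  have := (memLp_two_sq (h.memLp_sum n)).const_mul (n : ℝ)⁻¹
  refine MemLp.sub ?_ (memLp_const _)
  simpa only [div_eq_inv_mul] using this

lemma integral_sum_sq_div_sub (h : CenteredSample P X) {n : ℕ} (hn : 0 < n) :
    ∫ ω, ((∑ k ∈ Finset.range n, X k ω) ^ 2 / n - ∫ ω', X 0 ω' ^ 2 ∂P) ∂P = 0 := by
  have hn' : (n : ℝ) ≠ 0 := by exact_mod_cast hn.ne'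
  rw [integral_sub ((h.integrable_sum_pow n (by norm_num)).div_const _) (integrable_const _),
    integral_div, h.integral_sum_sq]
  field_simp
  simp

lemma integrable_sampleVariance_sub_sq (h : CenteredSample P X) {n : ℕ} (hn : 2 ≤ n) :
    Integrable (fun ω => (sampleVariance n (fun k => X k ω) - ∫ ω', X 0 ω' ^ 2 ∂P) ^ 2) P := by
  have h1 : MemLp (fun ω => ∑ k ∈ Finset.range n, (X k ω ^ 2 - ∫ ω', X 0 ω' ^ 2 ∂P)) 2 P :=
    memLp_finsetSum _ fun k _ => h.memLp_sq_sub k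
  have h2 := (h1.sub (h.memLp_sum_sq_div_sub n)).const_mul ((n : ℝ) - 1)⁻¹
  have h3 := h2.integrable_sq
  simp_rw [sampleVariance_sub hn]
  simpa only [div_eq_inv_mul, Pi.sub_apply] using h3

lemma integral_sampleVariance_sub_sq_le (h : CenteredSample P X) {n : ℕ} (hn : 2 ≤ n) :
    ∫ ω, (sampleVariance n (fun k => X k ω) - ∫ ω', X 0 ω' ^ 2 ∂P) ^ 2 ∂P
      ≤ 24 * (∫ ω, X 0 ω ^ 4 ∂P) / n := by
  have hn' : (2 : ℝ) ≤ n := by exact_mod_cast hn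
  have h1 : (0 : ℝ) < (n : ℝ) - 1 := by linarith
  have i1 : Integrable
      (fun ω => (∑ k ∈ Finset.range n, (X k ω ^ 2 - ∫ ω', X 0 ω' ^ 2 ∂P)) ^ 2) P :=
    MemLp.integrable_sq (memLp_finsetSum _ fun k _ => h.memLp_sq_sub k)
  have i2 := (h.memLp_sum_sq_div_sub n).integrable_sq
  have hle : ∫ ω, (sampleVariance n (fun k => X k ω) - ∫ ω', X 0 ω' ^ 2 ∂P) ^ 2 ∂P
      ≤ ∫ ω, (2 / ((n : ℝ) - 1) ^ 2) *
        ((∑ k ∈ Finset.range n, (X k ω ^ 2 - ∫ ω', X 0 ω' ^ 2 ∂P)) ^ 2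
        + ((∑ k ∈ Finset.range n, X k ω) ^ 2 / n - ∫ ω', X 0 ω' ^ 2 ∂P) ^ 2) ∂P := by
    refine integral_mono (h.integrable_sampleVariance_sub_sq hn) ((i1.add i2).const_mul _)
      fun ω => ?_
    simp only [sampleVariance_sub hn]
    rw [div_pow, div_mul_eq_mul_div]
    refine div_le_div_of_nonneg_right ?_ (by positivity)
    nlinarith [sq_nonneg (∑ k ∈ Finset.range n, (X k ω ^ 2 - ∫ ω', X 0 ω' ^ 2 ∂P)
      + ((∑ k ∈ Finset.range n, X k ω) ^ 2 / n - ∫ ω', X 0 ω' ^ 2 ∂P))]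
  rw [integral_const_mul, integral_add i1 i2, h.integral_sum_sq_sub_sq] at hle
  have h3 := h.integral_sum_sq_div_sub_sq_le (n := n) (by omega)
  have hm : 0 ≤ ∫ ω, X 0 ω ^ 4 ∂P := integral_nonneg fun ω => by positivity
  refine hle.trans ?_
  have h4 : n * (∫ ω, X 0 ω ^ 4 ∂P - (∫ ω, X 0 ω ^ 2 ∂P) ^ 2)
      + ∫ ω, ((∑ k ∈ Finset.range n, X k ω) ^ 2 / n - ∫ ω', X 0 ω' ^ 2 ∂P) ^ 2 ∂P
      ≤ (n + 3) * ∫ ω, X 0 ω ^ 4 ∂P := by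
    have : 0 ≤ (n : ℝ) * (∫ ω, X 0 ω ^ 2 ∂P) ^ 2 := by positivity
    linarith
  refine (mul_le_mul_of_nonneg_left h4 (by positivity)).trans ?_
  rw [div_mul_eq_mul_div, div_le_div_iff₀ (by positivity) (by linarith)]
  -- The constant 24 is governed by the smallest size n = 2, where this reads 20 ≤ 24.
  have : 2 * ((n : ℝ) + 3) * n ≤ 24 * ((n : ℝ) - 1) ^ 2 := by nlinarith
  nlinarith [mul_le_mul_of_nonneg_right this hm]

lemma integrable_abs_sampleVariance_sq_sub (h : CenteredSample P X) {n : ℕ} (hn : 2 ≤ n) :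
    Integrable (fun ω => |sampleVariance n (fun k => X k ω) ^ 2
      - (∫ ω', X 0 ω' ^ 2 ∂P) ^ 2|) P := by
  have hm := measurable_sampleVariance h.measurable n
  refine (((h.integrable_sampleVariance_sub_sq hn).const_mul 2).add
    (integrable_const (3 * (∫ ω', X 0 ω' ^ 2 ∂P) ^ 2))).mono
    ((hm.pow_const 2).sub_const _).abs.aestronglyMeasurable (ae_of_all _ fun ω => ?_)
  simp only [Pi.add_apply, Real.norm_eq_abs, abs_abs]
  refine le_trans ?_ (le_abs_self _)
  set a := sampleVariance n (fun k => X k ω)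
  set v := ∫ ω', X 0 ω' ^ 2 ∂P
  rw [abs_le]
  constructor <;> nlinarith [sq_nonneg (a - 2 * v), sq_nonneg a, sq_nonneg (a - v)]

lemma integral_abs_sampleVariance_sq_sub_le (h : CenteredSample P X) {n : ℕ} (hn : 2 ≤ n) :
    ∫ ω, |sampleVariance n (fun k => X k ω) ^ 2 - (∫ ω', X 0 ω' ^ 2 ∂P) ^ 2| ∂P
      ≤ 49 * (∫ ω, X 0 ω ^ 4 ∂P) / √n := by
  have hn' : (0 : ℝ) < n := by exact_mod_cast (by omega : 0 < n)
  have hs : 0 < √(n : ℝ) := Real.sqrt_pos.2 hn'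
  have hss : √(n : ℝ) ^ 2 = n := Real.sq_sqrt hn'.le
  have hs1 : 1 ≤ √(n : ℝ) := Real.one_le_sqrt.2 (by exact_mod_cast (by omega : 1 ≤ n))
  have hi := h.integrable_sampleVariance_sub_sq hn
  have hv := sq_integral_sq_le h.memLp_zero
  have hm : 0 ≤ ∫ ω, X 0 ω ^ 4 ∂P := integral_nonneg fun ω => by positivity
  have hle : ∫ ω, |sampleVariance n (fun k => X k ω) ^ 2 - (∫ ω', X 0 ω' ^ 2 ∂P) ^ 2| ∂P
      ≤ ∫ ω, ((1 + √n) * (sampleVariance n (fun k => X k ω) - ∫ ω', X 0 ω' ^ 2 ∂P) ^ 2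
        + (∫ ω', X 0 ω' ^ 2 ∂P) ^ 2 / √n) ∂P := by
    refine integral_mono (h.integrable_abs_sampleVariance_sq_sub hn)
      ((hi.const_mul _).add (integrable_const _)) fun ω => ?_
    exact abs_sq_sub_sq_le hs _ _
  rw [integral_add (hi.const_mul _) (integrable_const _), integral_const_mul] at hle
  simp only [integral_const, probReal_univ, one_smul] at hle
  refine hle.trans ?_
  have h1 := mul_le_mul_of_nonneg_left (h.integral_sampleVariance_sub_sq_le hn)
    (by positivity : 0 ≤ 1 + √(n : ℝ))
  -- Since 1 + √n ≤ 2√n, this part costs 48; the term v²/√n ≤ μ₄/√n raises it to 49.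
  have h2 : (1 + √(n : ℝ)) * (24 * (∫ ω, X 0 ω ^ 4 ∂P) / n)
      ≤ 48 * (∫ ω, X 0 ω ^ 4 ∂P) / √n := by
    rw [mul_div_assoc', div_le_div_iff₀ hn' hs]
    have : (1 + √(n : ℝ)) * 24 * √n ≤ 48 * n := by nlinarith
    nlinarith [mul_le_mul_of_nonneg_right this hm]
  have h3 := div_le_div_of_nonneg_right hv hs.le
  have e : 49 * (∫ ω, X 0 ω ^ 4 ∂P) / √n
      = 48 * (∫ ω, X 0 ω ^ 4 ∂P) / √n + (∫ ω, X 0 ω ^ 4 ∂P) / √n := by ring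
  rw [e]
  linarith

lemma integrable_fourth_bound (h : CenteredSample P X) (n : ℕ) :
    Integrable (fun ω => 15 / √n * ((∑ k ∈ Finset.range n, X k ω ^ 4) / n
        + (∑ k ∈ Finset.range n, X k ω) ^ 4 / n ^ 2)) P :=
  (((integrable_finsetSum _ fun k _ => h.integrable_pow k le_rfl).div_const _).add
    ((h.integrable_sum_pow n le_rfl).div_const _)).const_mul _

lemma integrable_abs_sampleFourthMoment_sub (h : CenteredSample P X) {n : ℕ} (hn : 0 < n) :
    Integrable (fun ω => |sampleFourthMoment n (fun k => X k ω)
      - (∑ k ∈ Finset.range n, X k ω ^ 4) / n|) P := by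
  have hm := measurable_sampleFourthMoment h.measurable n
  have hX := h.measurable
  refine (h.integrable_fourth_bound n).mono
    (Measurable.aestronglyMeasurable (by fun_prop)) (ae_of_all _ fun ω => ?_)
  rw [Real.norm_eq_abs, abs_abs]
  exact (abs_sampleFourthMoment_sub_le hn _).trans (le_abs_self _)

lemma integral_abs_sampleFourthMoment_sub_le (h : CenteredSample P X) {n : ℕ} (hn : 0 < n) :
    ∫ ω, |sampleFourthMoment n (fun k => X k ω) - (∑ k ∈ Finset.range n, X k ω ^ 4) / n| ∂P
      ≤ 60 * (∫ ω, X 0 ω ^ 4 ∂P) / √n := by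
  have hn' : (0 : ℝ) < n := by exact_mod_cast hn
  refine (integral_mono (h.integrable_abs_sampleFourthMoment_sub hn) (h.integrable_fourth_bound n)
    fun ω => abs_sampleFourthMoment_sub_le hn _).trans ?_
  have i1 : Integrable (fun ω => (∑ k ∈ Finset.range n, X k ω ^ 4) / n) P :=
    (integrable_finsetSum _ fun k _ => h.integrable_pow k le_rfl).div_const _
  rw [integral_const_mul, integral_add i1 ((h.integrable_sum_pow n le_rfl).div_const _),
    integral_div, integral_div, integral_finsetSum _ fun k _ => h.integrable_pow k le_rfl]
  simp only [h.integral_pow _ 4, Finset.sum_const, Finset.card_range, nsmul_eq_mul]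
  have h4 := div_le_div_of_nonneg_right (h.integral_sum_pow_four_le n)
    (by positivity : 0 ≤ (n : ℝ) ^ 2)
  have e1 : 3 * (n : ℝ) ^ 2 * (∫ ω, X 0 ω ^ 4 ∂P) / n ^ 2 = 3 * ∫ ω, X 0 ω ^ 4 ∂P := by
    field_simp
  have e2 : (n : ℝ) * (∫ ω, X 0 ω ^ 4 ∂P) / n = ∫ ω, X 0 ω ^ 4 ∂P := by field_simp
  rw [e1] at h4
  rw [e2]
  have := mul_le_mul_of_nonneg_left (add_le_add_right h4 (∫ ω, X 0 ω ^ 4 ∂P))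
    (by positivity : 0 ≤ 15 / √(n : ℝ))
  refine this.trans (le_of_eq ?_)
  ring

end CenteredSample
end MultiGroup

/-! ### Sums over groups: truncated weak law and L¹ error of the estimator. -/

namespace MultiGroup

variable {Ω : Type*} [MeasurableSpace Ω] {P : Measure Ω} [IsProbabilityMeasure P]

namespace CenteredGroups

variable {D : ℕ → ℕ → Ω → ℝ}

lemma groupSecond_sq_le (h : CenteredGroups P D) (i : ℕ) :
    groupSecond P D i ^ 2 ≤ groupFourth P D i :=
  sq_integral_sq_le (h.memLp_zero i)

lemma groupTail_antitone (h : CenteredGroups P D) (i : ℕ) :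
    Antitone fun M => groupTail P D M i := by
  intro M N hMN
  refine setIntegral_mono_set ((h.sample i).integrable_pow 0 le_rfl).integrableOn
    (ae_of_all _ fun ω => by positivity) ?_
  exact LE.le.eventuallyLE fun ω hω => lt_of_le_of_lt hMN hω

lemma integral_sum_mean_sq_le (h : CenteredGroups P D) (L : ℕ) {n : ℕ} (hn : 0 < n) :
    ∫ ω, (∑ i ∈ Finset.range L,
      ((∑ k ∈ Finset.range n, D i k ω) ^ 2 / n - groupSecond P D i)) ^ 2 ∂P
      ≤ 3 * ∑ i ∈ Finset.range L, groupFourth P D i := by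
  rw [integral_sum_sq_of_pairwise _
    (fun i ω => (∑ k ∈ Finset.range n, D i k ω) ^ 2 / n - groupSecond P D i)
    (fun i _ => (h.sample i).memLp_sum_sq_div_sub n) _
    (fun i _ => (h.sample i).integral_sum_sq_div_sub hn), Finset.mul_sum]
  · exact Finset.sum_le_sum fun i _ => (h.sample i).integral_sum_sq_div_sub_sq_le hn
  · intro i _ j _ hij
    exact (h.indepFun_sum n hij).comp (φ := fun x => x ^ 2 / n - groupSecond P D i)
      (ψ := fun x => x ^ 2 / n - groupSecond P D j) (by fun_prop) (by fun_prop)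

/-- Weak law of large numbers for the fourth powers, by truncation at the level `M`. -/
lemma integral_abs_sum_fourth_sub_le (h : CenteredGroups P D) (L : ℕ) {n : ℕ} (hn : 0 < n)
    {M δ : ℝ} (hM : 0 ≤ M) (hδ : 0 < δ) :
    ∫ ω, |∑ i ∈ Finset.range L,
      ((∑ k ∈ Finset.range n, D i k ω ^ 4) / n - groupFourth P D i)| ∂P
      ≤ δ + M * (∑ i ∈ Finset.range L, groupFourth P D i) / (n * δ)
        + 2 * ∑ i ∈ Finset.range L, groupTail P D M i := by
  have hn' : (0 : ℝ) < n := by exact_mod_cast hn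
  set s := Finset.range L ×ˢ Finset.range n with hs
  -- `u` is the part of the fourth power above M. The rest is at most M, so its square is at most M
  -- x⁴ and second moments exist although eighth moments may not.
  let u : ℝ → ℝ := {x : ℝ | M < x ^ 4}.indicator fun x => x ^ 4
  have hu : Measurable u := (measurable_id.pow_const 4).indicator
      (measurableSet_lt measurable_const (measurable_id.pow_const 4))
  have hu0 : ∀ x, 0 ≤ u x := fun x => Set.indicator_nonneg (fun x _ => by positivity) x
  have hu1 : ∀ x, u x ≤ x ^ 4 := fun x => Set.indicator_le_self' (fun x _ => by positivity) x
  have hu2 : ∀ x, (x ^ 4 - u x) ^ 2 ≤ M * x ^ 4 := by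
    intro x
    have hx4 : 0 ≤ x ^ 4 := by positivity
    by_cases hx : M < x ^ 4
    · have : u x = x ^ 4 := Set.indicator_of_mem (show x ∈ {x : ℝ | M < x ^ 4} from hx) _
      rw [this]
      simp only [sub_self]
      nlinarith
    · have : u x = 0 := Set.indicator_of_notMem (show x ∉ {x : ℝ | M < x ^ 4} from hx) _
      rw [this, sub_zero, sq]
      exact mul_le_mul_of_nonneg_right (not_lt.1 hx) hx4
  have hD := h.measurable
  have i4 : ∀ p : ℕ × ℕ, Integrable (fun ω => D p.1 p.2 ω ^ 4) P :=
    fun p => (h.sample p.1).integrable_pow p.2 le_rfl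
  have iu : ∀ p : ℕ × ℕ, Integrable (fun ω => u (D p.1 p.2 ω)) P := fun p =>
    (i4 p).mono (hu.comp (hD _ _)).aestronglyMeasurable (ae_of_all _ fun ω => by
      rw [Real.norm_eq_abs, Real.norm_eq_abs, abs_of_nonneg (hu0 _)]
      exact (hu1 _).trans (le_abs_self _))
  have eu : ∀ p : ℕ × ℕ, ∫ ω, u (D p.1 p.2 ω) ∂P = groupTail P D M p.1 := by
    intro p
    rw [← h.setIntegral_tail p.1 p.2 M, ← integral_indicator
      (measurableSet_lt measurable_const ((hD _ _).pow_const 4))]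
    rfl
  have e4 : ∀ p : ℕ × ℕ, ∫ ω, D p.1 p.2 ω ^ 4 ∂P = groupFourth P D p.1 :=
    fun p => (h.sample p.1).integral_pow p.2 4
  let w : ℕ → ℝ → ℝ := fun i x => x ^ 4 - u x - (groupFourth P D i - groupTail P D M i)
  have hw : ∀ i, Measurable (w i) := fun i => by fun_prop
  have hτ : ∀ p : ℕ × ℕ, MemLp (fun ω => D p.1 p.2 ω ^ 4 - u (D p.1 p.2 ω)) 2 P := by
    intro p
    refine (memLp_two_iff_integrable_sq (Measurable.aestronglyMeasurable (by fun_prop))).2 ?_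
    refine ((i4 p).const_mul M).mono (Measurable.aestronglyMeasurable (by fun_prop))
      (ae_of_all _ fun ω => ?_)
    rw [Real.norm_eq_abs, Real.norm_eq_abs, abs_of_nonneg (sq_nonneg _)]
    exact (hu2 _).trans (le_abs_self _)
  have hτ1 : ∀ p : ℕ × ℕ, ∫ ω, (D p.1 p.2 ω ^ 4 - u (D p.1 p.2 ω)) ∂P
      = groupFourth P D p.1 - groupTail P D M p.1 := fun p => by
    rw [integral_sub (i4 p) (iu p), e4, eu]
  have hw2 : ∀ p : ℕ × ℕ, MemLp (fun ω => w p.1 (D p.1 p.2 ω)) 2 P :=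
    fun p => (hτ p).sub (memLp_const _)
  have hw0 : ∀ p : ℕ × ℕ, ∫ ω, w p.1 (D p.1 p.2 ω) ∂P = 0 := fun p => by
    change ∫ ω, (D p.1 p.2 ω ^ 4 - u (D p.1 p.2 ω)
      - (groupFourth P D p.1 - groupTail P D M p.1)) ∂P = 0
    rw [integral_sub ((hτ p).integrable (by norm_num)) (integrable_const _), hτ1]
    simp
  have hwv : ∀ p : ℕ × ℕ, ∫ ω, w p.1 (D p.1 p.2 ω) ^ 2 ∂P ≤ M * groupFourth P D p.1 := by
    intro p
    rw [← variance_of_integral_eq_zero (hw2 p).aemeasurable (hw0 p)]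
    have : Var[fun ω => w p.1 (D p.1 p.2 ω); P]
        = Var[fun ω => D p.1 p.2 ω ^ 4 - u (D p.1 p.2 ω); P] :=
      variance_sub_const (hτ p).aestronglyMeasurable _
    rw [this]
    refine (variance_le_expectation_sq (hτ p).aestronglyMeasurable).trans ?_
    rw [← e4 p, ← integral_const_mul]
    exact integral_mono (hτ p).integrable_sq ((i4 p).const_mul M) fun ω => hu2 _
  have hA2 : ∫ ω, (∑ p ∈ s, w p.1 (D p.1 p.2 ω)) ^ 2 ∂P
      ≤ n * (M * ∑ i ∈ Finset.range L, groupFourth P D i) := by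
    rw [integral_sum_sq_of_pairwise s (fun p ω => w p.1 (D p.1 p.2 ω)) (fun p _ => hw2 p) _
      (fun p _ => hw0 p)]
    · refine (Finset.sum_le_sum fun p _ => hwv p).trans (le_of_eq ?_)
      rw [hs, Finset.sum_product]
      simp only [Finset.sum_const, Finset.card_range, nsmul_eq_mul]
      rw [← Finset.mul_sum, ← Finset.mul_sum]
    · intro p _ q _ hpq
      exact (h.indep.indepFun hpq).comp (φ := w p.1) (ψ := w q.1) (hw _) (hw _)
  have iA : MemLp (fun ω => ∑ p ∈ s, w p.1 (D p.1 p.2 ω)) 2 P :=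
    memLp_finsetSum _ fun p _ => hw2 p
  have ipt : ∀ p : ℕ × ℕ, Integrable (fun ω => u (D p.1 p.2 ω) + groupTail P D M p.1) P :=
    fun p => (iu p).add (integrable_const _)
  have iB : Integrable (fun ω => ∑ p ∈ s, (u (D p.1 p.2 ω) + groupTail P D M p.1)) P :=
    integrable_finsetSum _ fun p _ => ipt p
  have htail0 : ∀ i, 0 ≤ groupTail P D M i :=
    fun i => integral_nonneg fun ω => by positivity
  -- The centered truncated sum A is controlled by |A| ≤ nδ + A²/(nδ), which calls only for its
  -- variance. The part above M is bounded crudely, each tail entering twice.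
  have hpt : ∀ ω, |∑ i ∈ Finset.range L,
      ((∑ k ∈ Finset.range n, D i k ω ^ 4) / n - groupFourth P D i)|
      ≤ (n : ℝ)⁻¹ * (n * δ + ((n * δ : ℝ))⁻¹ * (∑ p ∈ s, w p.1 (D p.1 p.2 ω)) ^ 2
        + ∑ p ∈ s, (u (D p.1 p.2 ω) + groupTail P D M p.1)) := by
    intro ω
    have e : ∑ i ∈ Finset.range L,
        ((∑ k ∈ Finset.range n, D i k ω ^ 4) / n - groupFourth P D i)
        = (n : ℝ)⁻¹ * (∑ p ∈ s, w p.1 (D p.1 p.2 ω)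
          + ∑ p ∈ s, (u (D p.1 p.2 ω) - groupTail P D M p.1)) := by
      rw [← Finset.sum_add_distrib, hs, Finset.sum_product, Finset.mul_sum]
      refine Finset.sum_congr rfl fun i _ => ?_
      have : ∀ k, w i (D i k ω) + (u (D i k ω) - groupTail P D M i)
          = D i k ω ^ 4 - groupFourth P D i := fun k => by
        change D i k ω ^ 4 - u (D i k ω) - (groupFourth P D i - groupTail P D M i)
          + (u (D i k ω) - groupTail P D M i) = _
        ring
      simp only [this, Finset.sum_sub_distrib, Finset.sum_const, Finset.card_range, nsmul_eq_mul]
      field_simp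
    rw [e, abs_mul, abs_of_pos (inv_pos.2 hn')]
    refine mul_le_mul_of_nonneg_left ((abs_add_le _ _).trans (add_le_add ?_ ?_))
      (inv_pos.2 hn').le
    · set A := ∑ p ∈ s, w p.1 (D p.1 p.2 ω)
      have hc : (0 : ℝ) < n * δ := mul_pos hn' hδ
      have e1 : (n * δ : ℝ) * ((n * δ + ((n * δ : ℝ))⁻¹ * A ^ 2) - |A|)
          = (n * δ) ^ 2 + A ^ 2 - n * δ * |A| := by
        field_simp
      have e2 : 0 ≤ (n * δ) ^ 2 + A ^ 2 - n * δ * |A| := by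
        rw [← sq_abs A]
        nlinarith [sq_nonneg (n * δ - |A|), sq_nonneg (n * δ), sq_nonneg (|A|)]
      rw [← e1] at e2
      linarith [nonneg_of_mul_nonneg_right e2 hc]
    · refine (Finset.abs_sum_le_sum_abs _ _).trans (Finset.sum_le_sum fun p _ => ?_)
      rw [abs_le]
      constructor <;> linarith [hu0 (D p.1 p.2 ω), htail0 p.1]
  have iL : Integrable (fun ω => |∑ i ∈ Finset.range L,
      ((∑ k ∈ Finset.range n, D i k ω ^ 4) / n - groupFourth P D i)|) P :=
    (integrable_finsetSum _ fun i _ => ((integrable_finsetSum _ fun k _ =>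
      i4 (i, k)).div_const _).sub (integrable_const _)).abs
  have iA' := iA.integrable_sq.const_mul (n * δ : ℝ)⁻¹
  have iAc : Integrable (fun ω => n * δ
      + (n * δ : ℝ)⁻¹ * (∑ p ∈ s, w p.1 (D p.1 p.2 ω)) ^ 2) P :=
    (integrable_const _).add iA'
  refine (integral_mono iL ((iAc.add iB).const_mul _) hpt).trans ?_
  rw [integral_const_mul]
  simp only [Pi.add_apply]
  rw [integral_add iAc iB, integral_add (integrable_const _) iA',
    integral_const_mul (n * δ : ℝ)⁻¹, integral_finsetSum _ fun p _ => ipt p]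
  simp only [integral_const, probReal_univ, one_smul]
  have eB : ∑ p ∈ s, ∫ ω, (u (D p.1 p.2 ω) + groupTail P D M p.1) ∂P
      = n * (2 * ∑ i ∈ Finset.range L, groupTail P D M i) := by
    have : ∀ p : ℕ × ℕ, ∫ ω, (u (D p.1 p.2 ω) + groupTail P D M p.1) ∂P
        = 2 * groupTail P D M p.1 := fun p => by
      rw [integral_add (iu p) (integrable_const _), eu]
      simp
      ring
    simp only [this]
    rw [hs, Finset.sum_product]
    simp only [Finset.sum_const, Finset.card_range, nsmul_eq_mul]
    rw [← Finset.mul_sum, ← Finset.mul_sum]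
  rw [eB]
  have hA3 := mul_le_mul_of_nonneg_left hA2 (by positivity : 0 ≤ (n * δ : ℝ)⁻¹)
  refine (mul_le_mul_of_nonneg_left (add_le_add (add_le_add le_rfl hA3) le_rfl)
    (inv_pos.2 hn').le).trans (le_of_eq ?_)
  field_simp

lemma integrable_abs_sum_excess_sub (h : CenteredGroups P D) (L : ℕ) {n : ℕ} (hn : 2 ≤ n) :
    Integrable (fun ω => ∑ i ∈ Finset.range L,
      (sampleFourthMoment n (fun k => D i k ω) - sampleVariance n (fun k => D i k ω) ^ 2)
        - groupExcess P D L) P := by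
  refine (integrable_finsetSum _ fun i _ => Integrable.sub ?_ ?_).sub (integrable_const _)
  · have h1 := (h.sample i).integrable_abs_sampleFourthMoment_sub (n := n) (by omega)
    have h2 : Integrable (fun ω => (∑ k ∈ Finset.range n, D i k ω ^ 4) / n) P :=
      (integrable_finsetSum _ fun k _ => (h.sample i).integrable_pow k le_rfl).div_const _
    have hm := measurable_sampleFourthMoment (h.measurable i) n
    have hD := h.measurable
    have hd : Measurable (fun ω => sampleFourthMoment n (fun k => D i k ω)
        - (∑ k ∈ Finset.range n, D i k ω ^ 4) / n) := by fun_prop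
    have h3 := ((integrable_norm_iff hd.aestronglyMeasurable).1 h1).add h2
    refine h3.congr (ae_of_all _ fun ω => ?_)
    simp
  · have h1 := (h.sample i).integrable_abs_sampleVariance_sq_sub hn
    have hm := measurable_sampleVariance (h.measurable i) n
    have hd : Measurable (fun ω => sampleVariance n (fun k => D i k ω) ^ 2
        - (∫ ω', D i 0 ω' ^ 2 ∂P) ^ 2) := by fun_prop
    have h3 := ((integrable_norm_iff hd.aestronglyMeasurable).1 h1).add
      (integrable_const ((∫ ω', D i 0 ω' ^ 2 ∂P) ^ 2))
    refine h3.congr (ae_of_all _ fun ω => ?_)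
    simp

lemma integral_abs_sum_excess_sub_le (h : CenteredGroups P D) (L : ℕ) {n : ℕ} (hn : 2 ≤ n)
    {M δ : ℝ} (hM : 0 ≤ M) (hδ : 0 < δ) :
    ∫ ω, |∑ i ∈ Finset.range L,
      (sampleFourthMoment n (fun k => D i k ω) - sampleVariance n (fun k => D i k ω) ^ 2)
        - groupExcess P D L| ∂P
      ≤ 109 * (∑ i ∈ Finset.range L, groupFourth P D i) / √n + (δ
        + M * (∑ i ∈ Finset.range L, groupFourth P D i) / (n * δ)
        + 2 * ∑ i ∈ Finset.range L, groupTail P D M i) := by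
  have i1 : ∀ i, Integrable (fun ω => |sampleFourthMoment n (fun k => D i k ω)
      - (∑ k ∈ Finset.range n, D i k ω ^ 4) / n|) P :=
    fun i => (h.sample i).integrable_abs_sampleFourthMoment_sub (by omega)
  have i2 : ∀ i, Integrable (fun ω => |sampleVariance n (fun k => D i k ω) ^ 2
      - groupSecond P D i ^ 2|) P :=
    fun i => (h.sample i).integrable_abs_sampleVariance_sq_sub hn
  have i12' : ∀ i, Integrable (fun ω =>
      |sampleFourthMoment n (fun k => D i k ω) - (∑ k ∈ Finset.range n, D i k ω ^ 4) / n|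
        + |sampleVariance n (fun k => D i k ω) ^ 2 - groupSecond P D i ^ 2|) P :=
    fun i => (i1 i).add (i2 i)
  have i12 : Integrable (fun ω => ∑ i ∈ Finset.range L,
      (|sampleFourthMoment n (fun k => D i k ω) - (∑ k ∈ Finset.range n, D i k ω ^ 4) / n|
        + |sampleVariance n (fun k => D i k ω) ^ 2 - groupSecond P D i ^ 2|)) P :=
    integrable_finsetSum _ fun i _ => i12' i
  have i3 : Integrable (fun ω => |∑ i ∈ Finset.range L,
      ((∑ k ∈ Finset.range n, D i k ω ^ 4) / n - groupFourth P D i)|) P :=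
    (integrable_finsetSum _ fun i _ => ((integrable_finsetSum _ fun k _ =>
      (h.sample i).integrable_pow k le_rfl).div_const _).sub (integrable_const _)).abs
  have hpt : ∀ ω, |∑ i ∈ Finset.range L,
      (sampleFourthMoment n (fun k => D i k ω) - sampleVariance n (fun k => D i k ω) ^ 2)
        - groupExcess P D L| ≤ ∑ i ∈ Finset.range L,
      (|sampleFourthMoment n (fun k => D i k ω) - (∑ k ∈ Finset.range n, D i k ω ^ 4) / n|
        + |sampleVariance n (fun k => D i k ω) ^ 2 - groupSecond P D i ^ 2|)
      + |∑ i ∈ Finset.range L,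
      ((∑ k ∈ Finset.range n, D i k ω ^ 4) / n - groupFourth P D i)| := by
    intro ω
    -- Three errors: recentering the fourth moments (constant 60), the squared variances (49),
    -- together 109, and the weak law for d⁴.
    have e : ∑ i ∈ Finset.range L,
        (sampleFourthMoment n (fun k => D i k ω) - sampleVariance n (fun k => D i k ω) ^ 2)
          - groupExcess P D L
        = ∑ i ∈ Finset.range L,
          ((sampleFourthMoment n (fun k => D i k ω) - (∑ k ∈ Finset.range n, D i k ω ^ 4) / n)
            - (sampleVariance n (fun k => D i k ω) ^ 2 - groupSecond P D i ^ 2))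
          + ∑ i ∈ Finset.range L,
            ((∑ k ∈ Finset.range n, D i k ω ^ 4) / n - groupFourth P D i) := by
      rw [groupExcess, ← Finset.sum_sub_distrib, ← Finset.sum_add_distrib]
      exact Finset.sum_congr rfl fun i _ => by ring
    rw [e]
    refine (abs_add_le _ _).trans (add_le_add ((Finset.abs_sum_le_sum_abs _ _).trans
      (Finset.sum_le_sum fun i _ => abs_sub _ _)) le_rfl)
  refine (integral_mono (h.integrable_abs_sum_excess_sub L hn).abs (i12.add i3) hpt).trans ?_
  simp only [Pi.add_apply]
  rw [integral_add i12 i3]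
  refine add_le_add ?_ (h.integral_abs_sum_fourth_sub_le L (by omega) hM hδ)
  rw [integral_finsetSum _ fun i _ => i12' i, Finset.mul_sum, Finset.sum_div]
  refine Finset.sum_le_sum fun i _ => ?_
  rw [integral_add (i1 i) (i2 i)]
  refine (add_le_add ((h.sample i).integral_abs_sampleFourthMoment_sub_le (by omega))
    ((h.sample i).integral_abs_sampleVariance_sq_sub_le hn)).trans (le_of_eq ?_)
  rw [groupFourth]
  ring

end CenteredGroups

end MultiGroup

/-! ### Limit theorems and coverage along sequences (L_j, n_j). -/

namespace MultiGroup

variable {Ω : Type*} [MeasurableSpace Ω] {P : Measure Ω} [IsProbabilityMeasure P]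

lemma tendstoInMeasure_const_of_integral_abs_sub {f : ℕ → Ω → ℝ} {c : ℝ}
    (hi : ∀ j, Integrable (fun ω => f j ω - c) P)
    (h : Tendsto (fun j => ∫ ω, |f j ω - c| ∂P) atTop (𝓝 0)) :
    TendstoInMeasure P f atTop (fun _ => c) := by
  rw [tendstoInMeasure_iff_norm]
  intro ε hε
  have h1 : ∀ j, P {ω | ε ≤ ‖f j ω - c‖} ≤ ENNReal.ofReal (ε⁻¹ * ∫ ω, |f j ω - c| ∂P) := by
    intro j
    have := mul_meas_ge_le_integral_of_nonneg (μ := P) (f := fun ω => |f j ω - c|)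
      (ae_of_all _ fun ω => abs_nonneg _) (hi j).abs ε
    rw [← ofReal_measureReal]
    refine ENNReal.ofReal_le_ofReal ?_
    rw [inv_mul_eq_div, le_div_iff₀ hε, mul_comm]
    exact this
  refine tendsto_of_tendsto_of_tendsto_of_le_of_le tendsto_const_nhds ?_ (fun j => zero_le) h1
  rw [← ENNReal.ofReal_zero]
  refine ENNReal.tendsto_ofReal ?_
  simpa using h.const_mul ε⁻¹

/-- Carries L¹ convergence of the estimator over to its square root, including negative values,
where the root is 0. -/
lemma abs_sqrt_sub_one_le (e : ℝ) : |√e - 1| ≤ |e - 1| := by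
  rcases le_total e 0 with h | h
  · rw [Real.sqrt_eq_zero_of_nonpos h, abs_of_nonpos (by linarith : e - 1 ≤ 0)]
    norm_num
    linarith
  · have h1 : e - 1 = (√e - 1) * (√e + 1) := by
      nlinarith [Real.sq_sqrt h]
    rw [h1, abs_mul, abs_of_pos (by positivity : 0 < √e + 1)]
    exact le_mul_of_one_le_right (abs_nonneg _) (by linarith [Real.sqrt_nonneg e])

/-- As 0 ≤ v ≤ c, a deviation beyond c can only be upward, so d² > c. This turns the Lindeberg
condition for d² - v into a tail condition on d⁴. -/
lemma lindeberg_bound {d v c : ℝ} (hv : 0 ≤ v) (hvc : v ≤ c) (h : c < |d ^ 2 - v|) :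
    c ^ 2 < d ^ 4 ∧ (d ^ 2 - v) ^ 2 ≤ d ^ 4 := by
  rcases le_total v (d ^ 2) with hd | hd
  · rw [abs_of_nonneg (by linarith)] at h
    have h1 : c < d ^ 2 := by linarith
    have h2 : c ^ 2 < (d ^ 2) ^ 2 := pow_lt_pow_left₀ h1 (by linarith) (by norm_num)
    have h3 : (d ^ 2 - v) ^ 2 ≤ (d ^ 2) ^ 2 := pow_le_pow_left₀ (by linarith) (by linarith) 2
    constructor <;> nlinarith
  · rw [abs_of_nonpos (by linarith)] at h
    nlinarith [sq_nonneg d]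

/-- Uniformity of the fourth moments along a sequence of numbers of groups `L j` and of group sizes
`n j`. -/
structure UniformAlong (P : Measure Ω) (D : ℕ → ℕ → Ω → ℝ) (L n : ℕ → ℕ) (C : ℝ) : Prop where
  two_le : ∀ j, 2 ≤ n j
  tendsto : Tendsto n atTop atTop
  excess_pos : ∀ j, 0 < groupExcess P D (L j)
  bounded : ∀ j, ∑ i ∈ Finset.range (L j), groupFourth P D i ≤ C * groupExcess P D (L j)
  tails : ∀ ε : ℝ, 0 < ε → ∃ K : ℝ, ∀ᶠ j in atTop,
    ∑ i ∈ Finset.range (L j), groupTail P D (K * groupExcess P D (L j)) i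
      ≤ ε * groupExcess P D (L j)

namespace UniformAlong

variable {D : ℕ → ℕ → Ω → ℝ} {L n : ℕ → ℕ} {C : ℝ}

lemma tails_of_le (hD : CenteredGroups P D) (h : UniformAlong P D L n C) {ε : ℝ} (hε : 0 < ε) :
    ∃ K : ℝ, 0 ≤ K ∧ ∀ᶠ j in atTop, ∀ K' ≥ K,
      ∑ i ∈ Finset.range (L j), groupTail P D (K' * groupExcess P D (L j)) i
        ≤ ε * groupExcess P D (L j) := by
  obtain ⟨K, hK⟩ := h.tails ε hε
  refine ⟨max K 0, le_max_right _ _, hK.mono fun j hj K' hK' => le_trans ?_ hj⟩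
  exact Finset.sum_le_sum fun i _ => hD.groupTail_antitone i
    (mul_le_mul_of_nonneg_right ((le_max_left K 0).trans hK') (h.excess_pos j).le)

lemma tendsto_cast (h : UniformAlong P D L n C) :
    Tendsto (fun j => (n j : ℝ)) atTop atTop :=
  tendsto_natCast_atTop_atTop.comp h.tendsto

lemma tendsto_div_sqrt (h : UniformAlong P D L n C) (a : ℝ) :
    Tendsto (fun j => a / √(n j : ℝ)) atTop (𝓝 0) :=
  (Real.tendsto_sqrt_atTop.comp h.tendsto_cast).const_div_atTop a

/-- The normalized sums of the squares are asymptotically normal. -/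
lemma tendstoInDistribution_sum_sq (hD : CenteredGroups P D) (h : UniformAlong P D L n C) :
    TendstoInDistribution (fun j ω => ∑ p ∈ Finset.range (L j) ×ˢ Finset.range (n j),
      (D p.1 p.2 ω ^ 2 - groupSecond P D p.1) / √(n j * groupExcess P D (L j)))
      atTop id (fun _ => P) (gaussianReal 0 1) := by
  have hn : ∀ j, (0 : ℝ) < n j := fun j => by
    have := h.two_le j
    exact_mod_cast (by omega : 0 < n j)
  have hb : ∀ j, 0 < (n j : ℝ) * groupExcess P D (L j) := fun j =>
    mul_pos (hn j) (h.excess_pos j)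
  have hm := hD.measurable
  refine tendstoInDistribution_of_lindeberg (fun j => Finset.range (L j) ×ˢ Finset.range (n j))
    (fun j p ω => (D p.1 p.2 ω ^ 2 - groupSecond P D p.1) / √(n j * groupExcess P D (L j)))
    (fun j p => by fun_prop) (fun j => ?_) (fun j p => ?_) (fun j p => ?_) (fun j => ?_)
    (fun ε hε => ?_)
  · exact hD.indep.comp (fun p x => (x ^ 2 - groupSecond P D p.1)
      / √(n j * groupExcess P D (L j))) fun p => by fun_prop
  · have := ((hD.sample p.1).memLp_sq_sub p.2).const_mul (√(n j * groupExcess P D (L j)))⁻¹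
    simpa only [div_eq_inv_mul, groupSecond] using this
  · rw [integral_div]
    have := (hD.sample p.1).integral_sq_sub p.2
    rw [groupSecond, this, zero_div]
  · have e : ∀ p : ℕ × ℕ, ∫ ω, ((D p.1 p.2 ω ^ 2 - groupSecond P D p.1)
        / √(n j * groupExcess P D (L j))) ^ 2 ∂P
        = (groupFourth P D p.1 - groupSecond P D p.1 ^ 2) / (n j * groupExcess P D (L j)) := by
      intro p
      simp only [div_pow, Real.sq_sqrt (hb j).le]
      rw [integral_div]
      congr 1
      exact (hD.sample p.1).integral_sq_sub_sq p.2
    simp only [e]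
    rw [Finset.sum_product]
    simp only [Finset.sum_const, Finset.card_range, nsmul_eq_mul]
    rw [← Finset.mul_sum, ← Finset.sum_div, ← groupExcess]
    have := (h.excess_pos j).ne'
    have := (hn j).ne'
    field_simp
  -- The n identical observations of a group cancel the n in the normalization nV, leaving tails at
  -- level ε²nV. This level exceeds any KV once n ≥ K/ε², whatever L is.
  · have hbound : ∀ j, C / ε ^ 2 ≤ n j →
        ∑ p ∈ Finset.range (L j) ×ˢ Finset.range (n j),
          ∫ ω in {ω | ε < |(D p.1 p.2 ω ^ 2 - groupSecond P D p.1)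
            / √(n j * groupExcess P D (L j))|},
            ((D p.1 p.2 ω ^ 2 - groupSecond P D p.1) / √(n j * groupExcess P D (L j))) ^ 2 ∂P
        ≤ (groupExcess P D (L j))⁻¹ * ∑ i ∈ Finset.range (L j),
          groupTail P D (ε ^ 2 * n j * groupExcess P D (L j)) i := by
      intro j hj
      set b := (n j : ℝ) * groupExcess P D (L j) with hbdef
      have hbj : 0 < b := hb j
      have hsb : 0 < √b := Real.sqrt_pos.2 hbj
      have hterm : ∀ p ∈ Finset.range (L j) ×ˢ Finset.range (n j),
          ∫ ω in {ω | ε < |(D p.1 p.2 ω ^ 2 - groupSecond P D p.1) / √b|},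
            ((D p.1 p.2 ω ^ 2 - groupSecond P D p.1) / √b) ^ 2 ∂P
          ≤ b⁻¹ * groupTail P D (ε ^ 2 * n j * groupExcess P D (L j)) p.1 := by
        intro p hp
        -- Here v² ≤ μ₄ ≤ Σμ₄ ≤ CV ≤ ε²nV, the last by n ≥ C/ε².
        have hvc : groupSecond P D p.1 ≤ ε * √b := by
          refine le_of_sq_le_sq ?_ (by positivity)
          rw [mul_pow, Real.sq_sqrt hbj.le]
          refine (hD.groupSecond_sq_le p.1).trans ?_
          refine (Finset.single_le_sum (f := groupFourth P D)
            (fun i _ => CenteredGroups.groupFourth_nonneg i) (Finset.mem_product.1 hp).1).trans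
            ((h.bounded j).trans ?_)
          rw [div_le_iff₀ (by positivity)] at hj
          have := mul_le_mul_of_nonneg_right hj (h.excess_pos j).le
          rw [hbdef]
          linarith
        rw [← hD.setIntegral_tail p.1 p.2, ← integral_const_mul]
        have hmS : MeasurableSet {ω | ε < |(D p.1 p.2 ω ^ 2 - groupSecond P D p.1) / √b|} :=
          measurableSet_lt measurable_const (by fun_prop)
        have hmT : MeasurableSet {ω | ε ^ 2 * n j * groupExcess P D (L j) < D p.1 p.2 ω ^ 4} :=
          measurableSet_lt measurable_const (by fun_prop)
        have i4 : Integrable (fun ω => b⁻¹ * D p.1 p.2 ω ^ 4) P :=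
          ((hD.sample p.1).integrable_pow p.2 le_rfl).const_mul _
        have i2 : Integrable
            (fun ω => ((D p.1 p.2 ω ^ 2 - groupSecond P D p.1) / √b) ^ 2) P := by
          simp only [div_pow]
          exact ((hD.sample p.1).memLp_sq_sub p.2).integrable_sq.div_const _
        rw [← integral_indicator hmS, ← integral_indicator hmT]
        refine integral_mono (i2.indicator hmS) (i4.indicator hmT) fun ω => ?_
        by_cases hω : ω ∈ {ω | ε < |(D p.1 p.2 ω ^ 2 - groupSecond P D p.1) / √b|}
        · have hω' : ε * √b < |D p.1 p.2 ω ^ 2 - groupSecond P D p.1| := by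
            have : ε < |(D p.1 p.2 ω ^ 2 - groupSecond P D p.1) / √b| := hω
            rwa [abs_div, abs_of_pos hsb, lt_div_iff₀ hsb] at this
          have hl := lindeberg_bound (CenteredGroups.groupSecond_nonneg p.1) hvc hω'
          rw [mul_pow, Real.sq_sqrt hbj.le] at hl
          have hωT : ω ∈ {ω | ε ^ 2 * n j * groupExcess P D (L j) < D p.1 p.2 ω ^ 4} := by
            have := hl.1
            rw [hbdef, ← mul_assoc] at this
            exact this
          rw [Set.indicator_of_mem hω, Set.indicator_of_mem hωT, div_pow, Real.sq_sqrt hbj.le,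
            inv_mul_eq_div]
          exact div_le_div_of_nonneg_right hl.2 hbj.le
        · rw [Set.indicator_of_notMem hω]
          exact Set.indicator_nonneg (fun ω _ => by positivity) _
      refine (Finset.sum_le_sum hterm).trans (le_of_eq ?_)
      rw [Finset.sum_product]
      simp only [Finset.sum_const, Finset.card_range, nsmul_eq_mul]
      rw [← Finset.mul_sum, ← Finset.mul_sum, hbdef]
      have := (h.excess_pos j).ne'
      have := (hn j).ne'
      field_simp
    rw [Metric.tendsto_atTop']
    intro δ hδ
    obtain ⟨K, hK0, hK⟩ := h.tails_of_le hD (half_pos hδ)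
    have hev : ∀ᶠ j in atTop, max (C / ε ^ 2) (K / ε ^ 2) ≤ n j :=
      h.tendsto_cast.eventually_ge_atTop _
    obtain ⟨N, hN⟩ := eventually_atTop.1 (hK.and hev)
    refine ⟨N, fun j hj => ?_⟩
    obtain ⟨h1, h2⟩ := hN j hj.le
    have hKn : K ≤ ε ^ 2 * n j := by
      have := (le_max_right _ _).trans h2
      rwa [div_le_iff₀' (by positivity)] at this
    have h3 := (hbound j ((le_max_left _ _).trans h2)).trans
      (mul_le_mul_of_nonneg_left (h1 _ hKn) (inv_pos.2 (h.excess_pos j)).le)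
    have e : (groupExcess P D (L j))⁻¹ * (δ / 2 * groupExcess P D (L j)) = δ / 2 := by
      have := (h.excess_pos j).ne'
      field_simp
    rw [e] at h3
    rw [Real.dist_eq, sub_zero, abs_of_nonneg (Finset.sum_nonneg fun p _ =>
      integral_nonneg fun ω => sq_nonneg _)]
    linarith

/-- The contribution of the squared sample means is asymptotically negligible. -/
lemma integral_abs_mean_le (hD : CenteredGroups P D) (h : UniformAlong P D L n C) (j : ℕ) :
    ∫ ω, |(∑ i ∈ Finset.range (L j),
      ((∑ k ∈ Finset.range (n j), D i k ω) ^ 2 / n j - groupSecond P D i))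
        / √(n j * groupExcess P D (L j))| ∂P ≤ (1 + 3 * C) / √(n j : ℝ) := by
  have h2 := h.two_le j
  have hn : (0 : ℝ) < n j := by exact_mod_cast (by omega : 0 < n j)
  have hV := h.excess_pos j
  have hb : 0 < (n j : ℝ) * groupExcess P D (L j) := mul_pos hn hV
  have hs : 0 < √(n j : ℝ) := Real.sqrt_pos.2 hn
  set S : Ω → ℝ := fun ω => ∑ i ∈ Finset.range (L j),
      ((∑ k ∈ Finset.range (n j), D i k ω) ^ 2 / n j - groupSecond P D i) with hS
  have hSL : MemLp S 2 P := memLp_finsetSum _ fun i _ => (hD.sample i).memLp_sum_sq_div_sub (n j)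
  have hS2 : ∫ ω, S ω ^ 2 ∂P ≤ 3 * (C * groupExcess P D (L j)) :=
    (hD.integral_sum_mean_sq_le (L j) (by omega)).trans
      (mul_le_mul_of_nonneg_left (h.bounded j) (by norm_num))
  have i1 := hSL.integrable_sq.const_mul (√(n j : ℝ) / (n j * groupExcess P D (L j)))
  -- Pointwise |x| ≤ 1/√n + √n x², and the second moment of the quotient is at most 3C/n.
  have hle : ∫ ω, |S ω / √(n j * groupExcess P D (L j))| ∂P
      ≤ ∫ ω, (1 / √(n j : ℝ) + √(n j : ℝ) / (n j * groupExcess P D (L j)) * S ω ^ 2) ∂P := by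
    refine integral_mono ((hSL.integrable (by norm_num)).div_const _).abs
      ((integrable_const _).add i1) fun ω => ?_
    have e : √(n j : ℝ) / (n j * groupExcess P D (L j)) * S ω ^ 2
        = √(n j : ℝ) * (S ω / √(n j * groupExcess P D (L j))) ^ 2 := by
      rw [div_pow, Real.sq_sqrt hb.le]
      ring
    simp only [e]
    set x := S ω / √(n j * groupExcess P D (L j))
    rw [← sq_abs x, div_add' _ _ _ hs.ne', le_div_iff₀ hs]
    nlinarith [sq_nonneg (|x| * √(n j : ℝ) - 1), sq_nonneg (|x| * √(n j : ℝ))]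
  rw [integral_add (integrable_const _) i1, integral_const_mul] at hle
  simp only [integral_const, probReal_univ, one_smul] at hle
  have h3 := mul_le_mul_of_nonneg_left hS2
    (by positivity : 0 ≤ √(n j : ℝ) / (n j * groupExcess P D (L j)))
  have e3 : √(n j : ℝ) / (n j * groupExcess P D (L j)) * (3 * (C * groupExcess P D (L j)))
      = 3 * C / √(n j : ℝ) := by
    rw [div_mul_eq_mul_div, div_eq_div_iff hb.ne' hs.ne']
    have := Real.mul_self_sqrt hn.le
    linear_combination (3 * C * groupExcess P D (L j)) * this
  rw [e3] at h3
  refine hle.trans ((add_le_add le_rfl h3).trans (le_of_eq ?_))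
  ring

/-- Consistency of the variance estimator. -/
lemma tendsto_integral_abs_estimator_sub (hD : CenteredGroups P D)
    (h : UniformAlong P D L n C) :
    Tendsto (fun j => ∫ ω, |(∑ i ∈ Finset.range (L j),
      (sampleFourthMoment (n j) (fun k => D i k ω) - sampleVariance (n j) (fun k => D i k ω) ^ 2))
        / groupExcess P D (L j) - 1| ∂P) atTop (𝓝 0) := by
  rw [Metric.tendsto_atTop']
  intro δ hδ
  have hδ8 : 0 < δ / 8 := by linarith
  obtain ⟨K, hK0, hK⟩ := h.tails_of_le hD hδ8
  have h1 := (h.tendsto_div_sqrt (109 * C)).eventually_lt_const hδ8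
  have h2 := ((h.tendsto_cast).const_div_atTop (K * C / (δ / 8))).eventually_lt_const hδ8
  obtain ⟨N, hN⟩ := eventually_atTop.1 (hK.and (h1.and h2))
  refine ⟨N, fun j hj => ?_⟩
  obtain ⟨hKj, h1j, h2j⟩ := hN j hj.le
  have h2' := h.two_le j
  have hn : (0 : ℝ) < n j := by exact_mod_cast (by omega : 0 < n j)
  have hV := h.excess_pos j
  have hs : 0 < √(n j : ℝ) := Real.sqrt_pos.2 hn
  rw [Real.dist_eq, sub_zero, abs_of_nonneg (integral_nonneg fun ω => abs_nonneg _)]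
  have e : ∀ ω, |(∑ i ∈ Finset.range (L j),
      (sampleFourthMoment (n j) (fun k => D i k ω) - sampleVariance (n j) (fun k => D i k ω) ^ 2))
        / groupExcess P D (L j) - 1| = (groupExcess P D (L j))⁻¹ * |∑ i ∈ Finset.range (L j),
      (sampleFourthMoment (n j) (fun k => D i k ω) - sampleVariance (n j) (fun k => D i k ω) ^ 2)
        - groupExcess P D (L j)| := by
    intro ω
    rw [div_sub_one hV.ne', abs_div, abs_of_pos hV, div_eq_inv_mul]
  simp_rw [e]
  rw [integral_const_mul]
  -- Truncation level KV and slack (δ/8)V. After division by V the errors add up to at most 5δ/8: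
  -- one eighth each from recentering, the slack and the variance term, two from the tails.
  have hb := hD.integral_abs_sum_excess_sub_le (L j) h2'
    (mul_nonneg hK0 hV.le) (mul_pos hδ8 hV)
  have hF := h.bounded j
  have b1 : 109 * (∑ i ∈ Finset.range (L j), groupFourth P D i) / √(n j : ℝ)
      ≤ groupExcess P D (L j) * (109 * C / √(n j : ℝ)) := by
    rw [mul_div_assoc']
    exact div_le_div_of_nonneg_right (by linarith) hs.le
  have b2 : K * groupExcess P D (L j) * (∑ i ∈ Finset.range (L j), groupFourth P D i)
      / (n j * (δ / 8 * groupExcess P D (L j)))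
      ≤ groupExcess P D (L j) * (K * C / (δ / 8) / n j) := by
    have := div_le_div_of_nonneg_right (mul_le_mul_of_nonneg_left hF (mul_nonneg hK0 hV.le))
      (by positivity : 0 ≤ n j * (δ / 8 * groupExcess P D (L j)))
    refine this.trans (le_of_eq ?_)
    have := hV.ne'
    field_simp
  have b3 := hKj K le_rfl
  have t1 := mul_lt_mul_of_pos_left h1j hV
  have t2 := mul_lt_mul_of_pos_left h2j hV
  have hfin : ∫ ω, |∑ i ∈ Finset.range (L j),
      (sampleFourthMoment (n j) (fun k => D i k ω) - sampleVariance (n j) (fun k => D i k ω) ^ 2)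
        - groupExcess P D (L j)| ∂P < groupExcess P D (L j) * δ := by
    have := mul_pos hV hδ
    linarith
  rw [inv_mul_lt_iff₀ hV]
  exact hfin

end UniformAlong

/-- Multiplication by (n-1)/√(nV) > 0 normalizes the inequality. The factor (n-1)/n remains because
the sample variance divides by n-1 and the standard error by n. -/
lemma lowerBound_le_iff {z : ℝ} {L n : ℕ} (hn : 2 ≤ n) {V : ℝ} (hV : 0 < V) (x : ℕ → ℕ → ℝ)
    (v : ℕ → ℝ) :
    lowerBound z L n x ≤ ∑ i ∈ Finset.range L, v i ↔
      ∑ p ∈ Finset.range L ×ˢ Finset.range n, (x p.1 p.2 ^ 2 - v p.1) / √(n * V)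
        + -((∑ i ∈ Finset.range L, ((∑ k ∈ Finset.range n, x i k) ^ 2 / n - v i)) / √(n * V)
          + ((n : ℝ) - 1) / n * (z * √((∑ i ∈ Finset.range L,
            (sampleFourthMoment n (x i) - sampleVariance n (x i) ^ 2)) / V))) ≤ 0 := by
  have hn2 : (2 : ℝ) ≤ n := by exact_mod_cast hn
  have hn0 : (0 : ℝ) < n := by linarith
  have hn1 : (0 : ℝ) < (n : ℝ) - 1 := by linarith
  have hb : 0 < (n : ℝ) * V := mul_pos hn0 hV
  have hsb : 0 < √(n * V) := Real.sqrt_pos.2 hb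
  set E := ∑ i ∈ Finset.range L, (sampleFourthMoment n (x i) - sampleVariance n (x i) ^ 2)
  set A := ∑ p ∈ Finset.range L ×ˢ Finset.range n, (x p.1 p.2 ^ 2 - v p.1) with hA
  set B := ∑ i ∈ Finset.range L, ((∑ k ∈ Finset.range n, x i k) ^ 2 / n - v i) with hB
  have e1 : ∑ i ∈ Finset.range L, sampleVariance n (x i) - ∑ i ∈ Finset.range L, v i
      = (A - B) / ((n : ℝ) - 1) := by
    rw [hA, hB, Finset.sum_product, ← Finset.sum_sub_distrib, ← Finset.sum_sub_distrib,
      Finset.sum_div]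
    exact Finset.sum_congr rfl fun i _ => sampleVariance_sub hn (x i) (v i)
  have e2 : √(∑ i ∈ Finset.range L,
      1 / (n : ℝ) * (sampleFourthMoment n (x i) - sampleVariance n (x i) ^ 2))
      = √(n * V) / n * √(E / V) := by
    rw [← Finset.mul_sum]
    have : 1 / (n : ℝ) * E = (n * V) / n ^ 2 * (E / V) := by
      field_simp
    change √(1 / (n : ℝ) * E) = _
    rw [this, Real.sqrt_mul (by positivity), Real.sqrt_div hb.le, Real.sqrt_sq hn0.le]
  rw [lowerBound, e2, ← Finset.sum_div]
  have e3 : ∑ i ∈ Finset.range L, sampleVariance n (x i)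
      - z * (√(n * V) / n * √(E / V)) - ∑ i ∈ Finset.range L, v i
      = √(n * V) / ((n : ℝ) - 1) * (A / √(n * V)
        + -(B / √(n * V) + ((n : ℝ) - 1) / n * (z * √(E / V)))) := by
    have : ∑ i ∈ Finset.range L, sampleVariance n (x i)
      - z * (√(n * V) / n * √(E / V)) - ∑ i ∈ Finset.range L, v i
      = (A - B) / ((n : ℝ) - 1) - z * (√(n * V) / n * √(E / V)) := by
      rw [← e1]; ring
    rw [this]
    field_simp
    ring
  have hc : 0 < √(n * V) / ((n : ℝ) - 1) := div_pos hsb hn1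
  rw [← sub_nonpos, e3]
  constructor
  · intro hle
    exact nonpos_of_mul_nonpos_right hle hc
  · intro hle
    exact mul_nonpos_of_nonneg_of_nonpos hc.le hle

/-- Asymptotic coverage for centered observations along a sequence. -/
theorem tendsto_coverage_of_uniformAlong {D : ℕ → ℕ → Ω → ℝ} {L n : ℕ → ℕ} {C : ℝ}
    (hD : CenteredGroups P D) (h : UniformAlong P D L n C) {c z : ℝ}
    (hz : cdf (gaussianReal 0 1) z = c) :
    Tendsto (fun j => P.real {ω | lowerBound z (L j) (n j) (fun i k => D i k ω) ≤
      ∑ i ∈ Finset.range (L j), groupSecond P D i}) atTop (𝓝 c) := by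
  have hm := hD.measurable
  have hs4 : ∀ i n, Measurable fun ω => sampleFourthMoment n (fun k => D i k ω) :=
    fun i n => measurable_sampleFourthMoment (hm i) n
  have hs2 : ∀ i n, Measurable fun ω => sampleVariance n (fun k => D i k ω) :=
    fun i n => measurable_sampleVariance (hm i) n
  let W : ℕ → Ω → ℝ := fun j ω => ∑ p ∈ Finset.range (L j) ×ˢ Finset.range (n j),
      (D p.1 p.2 ω ^ 2 - groupSecond P D p.1) / √(n j * groupExcess P D (L j))
  let R : ℕ → Ω → ℝ := fun j ω => (∑ i ∈ Finset.range (L j),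
      ((∑ k ∈ Finset.range (n j), D i k ω) ^ 2 / n j - groupSecond P D i))
        / √(n j * groupExcess P D (L j))
  let E : ℕ → Ω → ℝ := fun j ω => (∑ i ∈ Finset.range (L j),
      (sampleFourthMoment (n j) (fun k => D i k ω) - sampleVariance (n j) (fun k => D i k ω) ^ 2))
        / groupExcess P D (L j)
  let Q : ℕ → Ω → ℝ := fun j ω => -(R j ω + ((n j : ℝ) - 1) / n j * (z * √(E j ω)))
  have hRm : ∀ j, Measurable (R j) := fun j => by fun_prop
  have hEm : ∀ j, Measurable (E j) := fun j => by fun_prop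
  have hQm : ∀ j, Measurable (Q j) := fun j => by fun_prop
  have hRi : ∀ j, Integrable (R j) P := fun j => by
    have : MemLp (fun ω => ∑ i ∈ Finset.range (L j),
      ((∑ k ∈ Finset.range (n j), D i k ω) ^ 2 / n j - groupSecond P D i)) 2 P :=
      memLp_finsetSum _ fun i _ => (hD.sample i).memLp_sum_sq_div_sub (n j)
    exact (this.integrable (by norm_num)).div_const _
  have hEi : ∀ j, Integrable (fun ω => E j ω - 1) P := fun j => by
    refine ((hD.integrable_abs_sum_excess_sub (L j) (h.two_le j)).div_const
      (groupExcess P D (L j))).congr (ae_of_all _ fun ω => ?_)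
    exact (div_sub_one (h.excess_pos j).ne').symm
  have hQb : ∀ j ω, |Q j ω - -z| ≤ |R j ω| + |z| * |E j ω - 1| + |z| / n j := by
    intro j ω
    have h2 := h.two_le j
    have hn2 : (2 : ℝ) ≤ n j := by exact_mod_cast h2
    have hn0 : (0 : ℝ) < n j := by linarith
    have e : Q j ω - -z = -(R j ω) + -(((n j : ℝ) - 1) / n j * (z * (√(E j ω) - 1))) + z / n j := by
      change -(R j ω + ((n j : ℝ) - 1) / n j * (z * √(E j ω))) - -z = _
      field_simp
      ring
    rw [e]
    refine (abs_add_le _ _).trans (add_le_add ((abs_add_le _ _).trans (add_le_add ?_ ?_)) ?_)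
    · rw [abs_neg]
    · rw [abs_neg, abs_mul, abs_mul]
      have h3 : |((n j : ℝ) - 1) / n j| ≤ 1 := by
        rw [abs_of_nonneg (div_nonneg (by linarith) hn0.le), div_le_one hn0]
        linarith
      refine (mul_le_of_le_one_left (by positivity) h3).trans ?_
      exact mul_le_mul_of_nonneg_left (abs_sqrt_sub_one_le _) (abs_nonneg z)
    · rw [abs_div, abs_of_pos hn0]
  have hBi : ∀ j, Integrable (fun ω => |R j ω| + |z| * |E j ω - 1| + |z| / n j) P := fun j =>
    ((hRi j).abs.add ((hEi j).abs.const_mul _)).add (integrable_const _)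
  have hQi : ∀ j, Integrable (fun ω => Q j ω - -z) P := fun j =>
    (hBi j).mono ((hQm j).sub_const _).aestronglyMeasurable (ae_of_all _ fun ω =>
      (hQb j ω).trans (le_abs_self _))
  have hR0 : Tendsto (fun j => ∫ ω, |R j ω| ∂P) atTop (𝓝 0) :=
    tendsto_of_tendsto_of_tendsto_of_le_of_le tendsto_const_nhds (h.tendsto_div_sqrt (1 + 3 * C))
      (fun j => integral_nonneg fun ω => abs_nonneg _) fun j => h.integral_abs_mean_le hD j
  have hE0 : Tendsto (fun j => ∫ ω, |E j ω - 1| ∂P) atTop (𝓝 0) :=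
    h.tendsto_integral_abs_estimator_sub hD
  have hQ0 : Tendsto (fun j => ∫ ω, |Q j ω - -z| ∂P) atTop (𝓝 0) := by
    have hlim : Tendsto (fun j => ∫ ω, |R j ω| ∂P + |z| * ∫ ω, |E j ω - 1| ∂P + |z| / n j)
        atTop (𝓝 0) := by
      have := (hR0.add (hE0.const_mul |z|)).add (h.tendsto_cast.const_div_atTop |z|)
      simpa using this
    refine tendsto_of_tendsto_of_tendsto_of_le_of_le tendsto_const_nhds hlim
      (fun j => integral_nonneg fun ω => abs_nonneg _) fun j => ?_
    refine (integral_mono (hQi j).abs (hBi j) (hQb j)).trans (le_of_eq ?_)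
    have i12 : Integrable (fun ω => |R j ω| + |z| * |E j ω - 1|) P :=
      (hRi j).abs.add ((hEi j).abs.const_mul _)
    rw [integral_add i12 (integrable_const _), integral_add (hRi j).abs
      ((hEi j).abs.const_mul _), integral_const_mul]
    simp
  -- Slutsky: W + Q converges in law to Z - z. The half-line up to 0 is a continuity set, its
  -- boundary pulling back to the Gaussian null set {z}.
  have hQt := tendstoInMeasure_const_of_integral_abs_sub hQi hQ0
  have hT := (h.tendstoInDistribution_sum_sq hD).add_of_tendstoInMeasure_const hQt
    fun j => (hQm j).aemeasurable
  have hWm : ∀ j, Measurable (W j) := fun j => by fun_prop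
  have hlaw : ∀ S : Set ℝ, MeasurableSet S →
      (gaussianReal 0 1).map (fun ω => id ω + -z) S
        = gaussianReal 0 1 ((fun ω => id ω + -z) ⁻¹' S) :=
    fun S hS => Measure.map_apply (by fun_prop) hS
  have hnull : (gaussianReal 0 1).map (fun ω => id ω + -z) (frontier (Set.Iic (0 : ℝ))) = 0 := by
    have := nullSingletonClass_gaussianReal (μ := 0) (v := 1) one_ne_zero
    rw [frontier_Iic, hlaw _ (measurableSet_singleton 0)]
    have e : (fun ω : ℝ => id ω + -z) ⁻¹' {0} = {z} := by
      ext ω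
      simp
    rw [e]
    exact measure_singleton z
  have key := ProbabilityMeasure.tendsto_measure_of_null_frontier_of_tendsto' hT.tendsto
    (E := Set.Iic (0 : ℝ)) hnull
  have hfin : (gaussianReal 0 1).map (fun ω => id ω + -z) (Set.Iic 0) ≠ ⊤ := by
    rw [hlaw _ measurableSet_Iic]
    exact measure_ne_top _ _
  have key2 := (ENNReal.tendsto_toReal hfin).comp key
  have elim : ((gaussianReal 0 1).map (fun ω => id ω + -z) (Set.Iic 0)).toReal = c := by
    rw [hlaw _ measurableSet_Iic, ← hz, cdf_eq_real, Measure.real]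
    congr 2
    ext ω
    simp
  rw [← elim]
  refine key2.congr fun j => ?_
  change (P.map (fun ω => W j ω + Q j ω) (Set.Iic 0)).toReal = _
  have hWQ : Measurable (fun ω => W j ω + Q j ω) := (hWm j).add (hQm j)
  rw [Measure.map_apply hWQ measurableSet_Iic, Measure.real]
  congr 2
  ext ω
  exact (lowerBound_le_iff (h.two_le j) (h.excess_pos j) (fun i k => D i k ω)
    (groupSecond P D)).symm

end MultiGroup

/-! ### Reduction to centered observations and the theorem. -/

namespace MultiGroup

variable {Ω : Type*} [MeasurableSpace Ω] {P : Measure Ω} [IsProbabilityMeasure P]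

lemma sampleMean_sub_const {n : ℕ} (hn : 0 < n) (x : ℕ → ℝ) (c : ℝ) :
    sampleMean n (fun k => x k - c) = sampleMean n x - c := by
  have hn' : (n : ℝ) ≠ 0 := by exact_mod_cast hn.ne'
  simp only [sampleMean, Finset.sum_sub_distrib, Finset.sum_const, Finset.card_range, nsmul_eq_mul]
  field_simp

lemma lowerBound_sub_const (z : ℝ) (L : ℕ) {n : ℕ} (hn : 0 < n) (x : ℕ → ℕ → ℝ) (c : ℕ → ℝ) :
    lowerBound z L n (fun i k => x i k - c i) = lowerBound z L n x := by
  have h2 : ∀ i, sampleVariance n (fun k => x i k - c i) = sampleVariance n (x i) := fun i => by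
    simp only [sampleVariance, sampleMean_sub_const hn, sub_sub_sub_cancel_right]
  have h4 : ∀ i, sampleFourthMoment n (fun k => x i k - c i) = sampleFourthMoment n (x i) :=
    fun i => by
      simp only [sampleFourthMoment, sampleMean_sub_const hn, sub_sub_sub_cancel_right]
  simp only [lowerBound, h2, h4]

/-- Asymptotic coverage for centered observations, with hypotheses that hold eventually. -/
lemma tendsto_coverage_of_eventually {D : ℕ → ℕ → Ω → ℝ} {L n : ℕ → ℕ} {C : ℝ}
    (hD : CenteredGroups P D) (hn : Tendsto n atTop atTop)
    (hV : ∀ᶠ j in atTop, 0 < groupExcess P D (L j))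
    (hC : ∀ᶠ j in atTop,
      ∑ i ∈ Finset.range (L j), groupFourth P D i ≤ C * groupExcess P D (L j))
    (htail : ∀ ε : ℝ, 0 < ε → ∃ K : ℝ, ∀ᶠ j in atTop,
      ∑ i ∈ Finset.range (L j), groupTail P D (K * groupExcess P D (L j)) i
        ≤ ε * groupExcess P D (L j)) {c z : ℝ}
    (hz : cdf (gaussianReal 0 1) z = c) :
    Tendsto (fun j => P.real {ω | lowerBound z (L j) (n j) (fun i k => D i k ω) ≤
      ∑ i ∈ Finset.range (L j), groupSecond P D i}) atTop (𝓝 c) := by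
  obtain ⟨N, hN⟩ := eventually_atTop.1 (hV.and (hC.and (hn.eventually_ge_atTop 2)))
  rw [← tendsto_add_atTop_iff_nat N]
  have hshift := tendsto_add_atTop_nat N
  refine tendsto_coverage_of_uniformAlong (L := fun j => L (j + N)) (n := fun j => n (j + N))
    (C := C) hD ⟨fun j => (hN _ (by omega)).2.2, hn.comp hshift, fun j => (hN _ (by omega)).1,
      fun j => (hN _ (by omega)).2.1, fun ε hε => ?_⟩ hz
  obtain ⟨K, hK⟩ := htail ε hε
  exact ⟨K, hshift.eventually hK⟩

/-- The sets decrease to ∅ and the fourth power is integrable. For a fixed number of groups this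
makes the tail condition automatic. -/
lemma CenteredGroups.tendsto_groupTail {D : ℕ → ℕ → Ω → ℝ} (h : CenteredGroups P D) {V : ℝ}
    (hV : 0 < V) (i : ℕ) : Tendsto (fun K : ℕ => groupTail P D (K * V) i) atTop (𝓝 0) := by
  have hm := h.measurable i 0
  have := tendsto_setIntegral_of_antitone (μ := P) (f := fun ω => D i 0 ω ^ 4)
    (s := fun K : ℕ => {ω | K * V < D i 0 ω ^ 4})
    (fun K => measurableSet_lt measurable_const (hm.pow_const 4))
    (fun K K' hK ω (hω : K' * V < D i 0 ω ^ 4) => lt_of_le_of_lt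
      (mul_le_mul_of_nonneg_right (by exact_mod_cast hK) hV.le) hω)
    ⟨0, ((h.sample i).integrable_pow 0 le_rfl).integrableOn⟩
  have e : (⋂ K : ℕ, {ω | K * V < D i 0 ω ^ 4}) = ∅ := by
    ext ω
    simp only [Set.mem_iInter, Set.mem_ofPred_eq, Set.mem_empty_iff_false, iff_false, not_forall,
      not_lt]
    obtain ⟨K, hK⟩ := exists_nat_ge (D i 0 ω ^ 4 / V)
    exact ⟨K, (div_le_iff₀ hV).1 hK⟩
  rw [e, setIntegral_empty] at this
  exact this

end MultiGroup

open MultiGroup in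
theorem mainTheorem7 {Ω : Type*} [MeasurableSpace Ω] (P : Measure Ω) [IsProbabilityMeasure P]
    (Y : ℕ → ℕ → Ω → ℝ) (hmeas : ∀ i k, Measurable (Y i k))
    (hindep : iIndepFun (fun p : ℕ × ℕ => Y p.1 p.2) P)
    (hident : ∀ i k, IdentDistrib (Y i k) (Y i 0) P P)
    (hmom : ∀ i, MemLp (Y i 0) 4 P)
    (hnondeg : ∃ i, variance (Y i 0) P ^ 2 < centralMoment (Y i 0) 4 P)
    (β z : ℝ) (hβ : β ∈ Set.Ioo (0 : ℝ) 1) (hz : cdf (gaussianReal 0 1) z = 1 - β) :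
    (∀ L : ℕ, 0 < MultiGroup.totalExcess P (fun i => Y i 0) L →
      Tendsto (fun n : ℕ => P.real {ω | MultiGroup.lowerBound z L n (fun i k => Y i k ω) ≤
          MultiGroup.totalVariance P (fun i => Y i 0) L})
        atTop (𝓝 (1 - β))) ∧
    (MultiGroup.UniformFourthMoments P (fun i => Y i 0) →
      Tendsto (fun q : ℕ × ℕ =>
          P.real {ω | MultiGroup.lowerBound z q.1 q.2 (fun i k => Y i k ω) ≤
            MultiGroup.totalVariance P (fun i => Y i 0) q.1})
        (atTop ×ˢ atTop) (𝓝 (1 - β))) := by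
  let D : ℕ → ℕ → Ω → ℝ := fun i k ω => Y i k ω - ∫ ω', Y i 0 ω' ∂P
  have hD : CenteredGroups P D := by
    refine ⟨fun i k => (hmeas i k).sub_const _, ?_, fun i k => ?_, fun i => ?_, fun i => ?_⟩
    · exact hindep.comp (fun p x => x - ∫ ω', Y p.1 0 ω' ∂P) fun p => by fun_prop
    · exact (hident i k).comp (u := fun x => x - ∫ ω', Y i 0 ω' ∂P) (by fun_prop)
    · exact (hmom i).sub (memLp_const _)
    · change ∫ ω, (Y i 0 ω - ∫ ω', Y i 0 ω' ∂P) ∂P = 0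
      rw [integral_sub ((hmom i).integrable (by norm_num)) (integrable_const _)]
      simp
  have e2 : ∀ i, variance (Y i 0) P = groupSecond P D i :=
    fun i => variance_eq_integral (hmeas i 0).aemeasurable
  have e4 : ∀ i, centralMoment (Y i 0) 4 P = groupFourth P D i := fun i => rfl
  have eV : ∀ L, totalExcess P (fun i => Y i 0) L = groupExcess P D L := fun L => by
    simp only [totalExcess, groupExcess, e2, e4]
  have hmain : ∀ L n : ℕ → ℕ, ∀ C : ℝ, Tendsto n atTop atTop →
      (∀ᶠ j in atTop, 0 < groupExcess P D (L j)) →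
      (∀ᶠ j in atTop,
        ∑ i ∈ Finset.range (L j), groupFourth P D i ≤ C * groupExcess P D (L j)) →
      (∀ ε : ℝ, 0 < ε → ∃ K : ℝ, ∀ᶠ j in atTop,
        ∑ i ∈ Finset.range (L j), groupTail P D (K * groupExcess P D (L j)) i
          ≤ ε * groupExcess P D (L j)) →
      Tendsto (fun j => P.real {ω | lowerBound z (L j) (n j) (fun i k => Y i k ω) ≤
        totalVariance P (fun i => Y i 0) (L j)}) atTop (𝓝 (1 - β)) := by
    intro L n C hn hV hC ht
    refine (tendsto_coverage_of_eventually hD hn hV hC ht hz).congr' ?_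
    -- The sample mean commutes with shifts only for n > 0, hence the agreement is claimed
    -- eventually.
    filter_upwards [hn.eventually_gt_atTop 0] with j hj
    simp only [totalVariance, e2, D, lowerBound_sub_const z (L j) hj]
  constructor
  · intro L hL
    rw [eV] at hL
    refine hmain (fun _ => L) id
      ((∑ i ∈ Finset.range L, groupFourth P D i) / groupExcess P D L) tendsto_id
      (Eventually.of_forall fun _ => hL) (Eventually.of_forall fun _ => ?_) fun ε hε => ?_
    · rw [div_mul_cancel₀ _ hL.ne']
    · have hlim : Tendsto (fun K : ℕ => ∑ i ∈ Finset.range L,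
          groupTail P D (K * groupExcess P D L) i) atTop (𝓝 0) := by
        simpa using tendsto_finsetSum (Finset.range L) fun i _ => hD.tendsto_groupTail hL i
      obtain ⟨K, hK⟩ := (hlim.eventually_le_const (mul_pos hε hL)).exists
      exact ⟨K, Eventually.of_forall fun _ => hK⟩
  · intro hU
    -- The product filter is countably generated, so sequences with both coordinates tending to
    -- infinity suffice.
    refine tendsto_of_seq_tendsto fun q hq => ?_
    have hq1 : Tendsto (fun j => (q j).1) atTop atTop := tendsto_fst.comp hq
    have hq2 : Tendsto (fun j => (q j).2) atTop atTop := tendsto_snd.comp hq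
    obtain ⟨C, hC⟩ := hU.bounded
    simp only [eV, e4] at hC
    refine hmain (fun j => (q j).1) (fun j => (q j).2) C hq2 ?_ (hq1.eventually hC)
      fun ε hε => ?_
    -- Every summand of the excess is nonnegative, so it is positive as soon as the nondegenerate
    -- group i is included.
    · obtain ⟨i, hi⟩ := hnondeg
      rw [e2, e4] at hi
      filter_upwards [hq1.eventually_gt_atTop i] with j hj
      exact (sub_pos.2 hi).trans_le (Finset.single_le_sum
        (f := fun i => groupFourth P D i - groupSecond P D i ^ 2)
        (fun i _ => sub_nonneg.2 (hD.groupSecond_sq_le i)) (Finset.mem_range.2 hj))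
    · obtain ⟨K, hK⟩ := hU.tails ε hε
      simp only [eV] at hK
      exact ⟨K, hq1.eventually hK⟩
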